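/- Consider a two-station tandem of single-server first-come-first-served queues with infinite buffers. Customer $n\in\mathbb Z$ arrives at station 1 at time $T_n$, has service time $\sigma^{(1)}_n\ge 0$ there, then moves to station 2, where it has service time $\sigma^{(2)}_n\ge 0$; let $\tau_n=T_{n+1}-T_n\ge 0$ be the interarrival times. Assume that $\{\tau_n\}$, $\{\sigma^{(1)}_n\}$, $\{\sigma^{(2)}_n\}$ are three mutually independent sequences of i.i.d. random variables, with means $a=\mathbf E\tau_n<\infty$, $b^{(i)}=\mathbf E\sigma^{(i)}_n$, and that the network is stable, i.e. $b^{(1)}<a$ and $b^{(2)}<a$. Put $b=\max(b^{(1)},b^{(2)})$. Let $F$ be a distribution function on $[0,\infty)$, with tail $\overline F=1-F$, such that $\int_0^\infty \overline F(u)\,du<\infty$, and such that both $F$ and the integrated tail distribution $F^s(x)=1-\min\{1,\int_x^\infty\overline F(u)\,du\}$, $x\ge 0$, are subexponential. (A distribution function $G$ on $[0,\infty)$ with $\overline G(x)=1-G(x)>0$ for all $x$ is subexponential if $\mathbf P(\xi_1+\xi_2>x)\sim 2\,\overline G(x)$ as $x\to\infty$ for independent $\xi_1,\xi_2$ with distribution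 function $G$.) Assume that, for $i=1,2$, $\mathbf P(\sigma^{(i)}_0>x)\sim d^{(i)}\,\overline F(x)$ as $x\to\infty$, with $d^{(1)},d^{(2)}\ge 0$ and $d^{(1)}+d^{(2)}>0$; here $f\sim d\,g$ means $f(x)/g(x)\to d$ (so $f=o(g)$ if $d=0$). Let $Z_{[-n,0]}$ be the end-to-end delay of customer $0$ (the time from its arrival at station 1 to its departure from station 2) when the network starts empty and is fed only by the customers $-n,\dots,0$. This is nondecreasing in $n$; let $Z=\lim_{n\to\infty}Z_{[-n,0]}$ be the stationary end-to-end delay. Then, as $x\to\infty$, $$\mathbf P(Z>x)\sim\left(\frac{d^{(1)}}{a-b}+\frac{d^{(2)}}{a-b^{(2)}}\right)\overline{F^s}(x),\qquad \overline{F^s}=1-F^s .$$ -/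

import Mathlib

open MeasureTheory ProbabilityTheory Filter Topology Set

noncomputable section

/-- `G` (restricted to `[0, ∞)`) is a subexponential distribution function on `[0, ∞)`: it is the
distribution function of a probability law `ν` on `[0, ∞)` with unbounded support for which
`P(ξ₁ + ξ₂ > x) ∼ 2 P(ξ₁ > x)` as `x → ∞`, with `ξ₁, ξ₂` independent of law `ν`
(so that `ξ₁ + ξ₂` has law `ν ∗ ν`). -/
def IsSubexponential (G : ℝ → ℝ) : Prop :=
  ∃ ν : Measure ℝ, IsProbabilityMeasure ν ∧ ν (Iio 0) = 0 ∧
    (∀ x, 0 ≤ x → G x = ν.real (Iic x)) ∧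
    (∀ x, 0 < ν (Ioi x)) ∧
    Tendsto (fun x : ℝ => (Measure.conv ν ν).real (Ioi x) / ν.real (Ioi x)) atTop (𝓝 2)

/-- The integrated tail distribution function
`F^s(x) = 1 - min {1, ∫_x^∞ (1 - F(u)) du}`, for `x ≥ 0`. -/
def integratedTail (F : ℝ → ℝ) (x : ℝ) : ℝ :=
  1 - min 1 (∫ u in Ioi x, (1 - F u))

/-- First-come-first-served single-server tandem, fed by the customers `m, m + 1, m + 2, …` only
and starting empty. Customer `n` arrives at time `T n` and has service time `s₁ n` at station 1.
`departure₁ T s₁ m k` is the time at which customer `m + k` leaves station 1. -/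
def departure₁ (T s₁ : ℤ → ℝ) (m : ℤ) : ℕ → ℝ
  | 0 => T m + s₁ m
  | k + 1 => max (T (m + (k + 1))) (departure₁ T s₁ m k) + s₁ (m + (k + 1))

/-- In the same system, `departure₂ T s₁ s₂ m k` is the time at which customer `m + k` leaves
station 2, where its service time is `s₂ (m + k)`; customers enter the queue of station 2 when they
leave station 1. -/
def departure₂ (T s₁ s₂ : ℤ → ℝ) (m : ℤ) : ℕ → ℝ
  | 0 => departure₁ T s₁ m 0 + s₂ m
  | k + 1 => max (departure₁ T s₁ m (k + 1)) (departure₂ T s₁ s₂ m k) + s₂ (m + (k + 1))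

/-- The maximal dater `Z_{[-n,0]}`: the end-to-end delay of customer `0` (from its arrival at
station 1 to its departure from station 2) when the system is fed by the customers `-n, …, 0`. -/
def delayFrom (T s₁ s₂ : ℤ → ℝ) (n : ℕ) : ℝ :=
  departure₂ T s₁ s₂ (-n) n - T 0

/-- The stationary end-to-end delay `Z = lim_{n → ∞} Z_{[-n,0]} ∈ (-∞, ∞]`. The sequence is
nondecreasing, so the limit is the supremum; see `tendsto_delayFrom`. -/
def stationaryDelay (T s₁ s₂ : ℤ → ℝ) : EReal :=
  ⨆ n : ℕ, (delayFrom T s₁ s₂ n : EReal)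

theorem departure₁_le (T s₁ : ℤ → ℝ) (m : ℤ) (k : ℕ) :
    departure₁ T s₁ m k ≤ departure₁ T s₁ (m - 1) (k + 1) := by
  induction k with
  | zero => simp [departure₁]
  | succ k ih =>
    have h : m - 1 + (((k + 1 : ℕ) : ℤ) + 1) = m + ((k : ℤ) + 1) := by push_cast; ring
    rw [departure₁, departure₁, h]
    gcongr

theorem departure₂_le (T s₁ s₂ : ℤ → ℝ) (m : ℤ) (k : ℕ) :
    departure₂ T s₁ s₂ m k ≤ departure₂ T s₁ s₂ (m - 1) (k + 1) := by
  induction k with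
  | zero =>
    have h : m - 1 + (((0 : ℕ) : ℤ) + 1) = m := by push_cast; ring
    rw [departure₂, departure₂, h]
    gcongr
    exact (departure₁_le T s₁ m 0).trans (le_max_left _ _)
  | succ k ih =>
    have h : m - 1 + (((k + 1 : ℕ) : ℤ) + 1) = m + ((k : ℤ) + 1) := by push_cast; ring
    rw [departure₂, departure₂, h]
    gcongr
    exact departure₁_le T s₁ m (k + 1)

theorem monotone_delayFrom (T s₁ s₂ : ℤ → ℝ) : Monotone (delayFrom T s₁ s₂) := by
  refine monotone_nat_of_le_succ fun n => ?_
  have h := departure₂_le T s₁ s₂ (-n) n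
  have e : (-((n + 1 : ℕ) : ℤ)) = -n - 1 := by push_cast; ring
  unfold delayFrom
  rw [e]
  linarith

theorem tendsto_delayFrom (T s₁ s₂ : ℤ → ℝ) :
    Tendsto (fun n => (delayFrom T s₁ s₂ n : EReal)) atTop (𝓝 (stationaryDelay T s₁ s₂)) :=
  tendsto_atTop_iSup fun _ _ h => EReal.coe_le_coe_iff.2 (monotone_delayFrom T s₁ s₂ h)

end

/-! The delay is a maximum over paths: for some `i ≤ j`, service times at station 1 of the customers
`-j, …, -i`, plus service times at station 2 of the customers `-i, …, 0`, minus the interarrival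
times between `-j` and `0`. Its tail comes from a single big jump. A huge service time of customer
`-k` at station 2 is worn down by about `a - b₂` per later customer. At station 1 it is worn down by
only `a - b`, since the released work must still pass the slower of the two stations. So the jump
must exceed about `x + k (a - b₂)` or `x + k (a - b)`, and summing `P(σ > x + k c)` over `k` gives
`d / c` times the integrated tail.

Lower bound (`eventually_le_of_single_big_jump`): with `c` and `c₂` slightly above the true drifts,
each big jump occurs together with an independent, likely event on which the rest of the path is
typical. The jump events are pairwise independent with small total probability, so a Bonferroni
argument adds them up with negligible loss.

Upper bound (`eventually_tandemMax_le`): up to three service times with negligible tail, the delay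
is at most the running maximum of a subadditive functional, `tandemWalk`. With `c` and `c₂` slightly
below the true drifts, stop when a barrier `r - k c` or `r - k c₂` is first exceeded. Subadditivity
and independence give a defective renewal inequality whose kernel has mass `γ`, the probability of
ever crossing, and tail at most about `m = d₁ / c + d₂ / c₂` times the integrated tail.
Subexponentiality turns this into the bound `m / (1 - γ)`, uniformly in the horizon, and `γ → 0` as
`r → ∞` by the law of large numbers. -/

open scoped ENNReal

/-! ### Subexponential laws and tails of convolutions -/

/-- A subexponential probability law on `[0, ∞)`. -/
structure IsSubexpLaw (ν : Measure ℝ) : Prop where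
  prob : IsProbabilityMeasure ν
  nonneg : ν (Iio 0) = 0
  pos : ∀ x, 0 < ν (Ioi x)
  tendsto_conv : Tendsto (fun x : ℝ => (Measure.conv ν ν).real (Ioi x) / ν.real (Ioi x)) atTop (𝓝 2)

/-- The pairs with both coordinates above `T` and with sum above `x`. -/
def bothLarge (T x : ℝ) : Set (ℝ × ℝ) := {p | T < p.1 ∧ T < p.2 ∧ x < p.1 + p.2}

theorem measurableSet_bothLarge (T x : ℝ) : MeasurableSet (bothLarge T x) :=
  (measurableSet_lt measurable_const measurable_fst).inter
    ((measurableSet_lt measurable_const measurable_snd).inter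
      (measurableSet_lt measurable_const (measurable_fst.add measurable_snd)))

theorem measurableSet_sum_gt (x : ℝ) : MeasurableSet {p : ℝ × ℝ | x < p.1 + p.2} :=
  measurableSet_lt measurable_const (measurable_fst.add measurable_snd)

theorem tendsto_real_Ioi_zero (ν : Measure ℝ) [IsFiniteMeasure ν] :
    Tendsto (fun x => ν.real (Ioi x)) atTop (𝓝 0) := by
  have h := tendsto_measure_iInter_atTop (μ := ν) (s := fun x : ℝ => Ioi x)
    (fun x => measurableSet_Ioi.nullMeasurableSet) (fun x y h => Ioi_subset_Ioi h)
    ⟨0, measure_ne_top _ _⟩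
  have e : (⋂ n : ℝ, Ioi n) = ∅ := by
    ext x; simp only [mem_iInter, mem_Ioi, mem_empty_iff_false, iff_false, not_forall, not_lt]
    exact ⟨x, le_rfl⟩
  rw [e, measure_empty] at h
  exact (ENNReal.tendsto_toReal ENNReal.zero_ne_top).comp h

theorem antitone_real_Ioi (ν : Measure ℝ) [IsFiniteMeasure ν] :
    Antitone (fun x => ν.real (Ioi x)) := fun _ _ h => measureReal_mono (Ioi_subset_Ioi h)

theorem conv_real_Ioi (ν : Measure ℝ) (x : ℝ) :
    (Measure.conv ν ν).real (Ioi x) = (ν.prod ν).real {p : ℝ × ℝ | x < p.1 + p.2} := by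
  rw [Measure.conv, map_measureReal_apply (by fun_prop) measurableSet_Ioi]
  rfl

namespace IsSubexpLaw

variable {ν : Measure ℝ} (hν : IsSubexpLaw ν)

include hν

theorem real_pos (x : ℝ) : 0 < ν.real (Ioi x) := by
  have := hν.prob
  exact ENNReal.toReal_pos (hν.pos x).ne' (measure_ne_top _ _)

theorem real_Icc (y : ℝ) : ν.real (Icc 0 y) = 1 - ν.real (Ioi y) := by
  have := hν.prob
  have h1 : ν.real (Icc 0 y) = ν.real (Iic y) := by
    apply measureReal_congr
    have h0 : ∀ᵐ t ∂ν, 0 ≤ t := by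
      rw [ae_iff]; convert! hν.nonneg using 2; ext; simp
    filter_upwards [h0] with t ht
    apply propext
    change (0 ≤ t ∧ t ≤ y) ↔ t ≤ y
    simp [ht]
  rw [h1, ← compl_Ioi, probReal_compl_eq_one_sub measurableSet_Ioi]

/-- Three disjoint boxes lie inside `{p + q > x}`: first coordinate above `x`; first in `[0, y]` and
second above `x`; first in `(y, x]` and second above `x - y`. The third box is the one that sees the
shifted tail. -/
theorem conv_ge {x y : ℝ} (hx : y < x) :
    ν.real (Ioi x) + (1 - ν.real (Ioi y)) * ν.real (Ioi x)
      + (ν.real (Ioi y) - ν.real (Ioi x)) * ν.real (Ioi (x - y))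
      ≤ (Measure.conv ν ν).real (Ioi x) := by
  have := hν.prob
  have hI : ν.real (Ici 0) = 1 := by
    rw [← compl_Iio, probReal_compl_eq_one_sub measurableSet_Iio]
    simp [Measure.real, hν.nonneg]
  have h3 : ν.real (Ioc y x) = ν.real (Ioi y) - ν.real (Ioi x) := by
    rw [← Ioi_sdiff_Ioi, measureReal_sdiff (Ioi_subset_Ioi hx.le) measurableSet_Ioi]
  have e1 : ν.real (Ioi x) = (ν.prod ν).real (Ioi x ×ˢ Ici 0) := by
    rw [measureReal_prod_prod, hI, mul_one]
  have e2 : (1 - ν.real (Ioi y)) * ν.real (Ioi x) = (ν.prod ν).real (Icc 0 y ×ˢ Ioi x) := by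
    rw [measureReal_prod_prod, hν.real_Icc]
  have e3 : (ν.real (Ioi y) - ν.real (Ioi x)) * ν.real (Ioi (x - y))
      = (ν.prod ν).real (Ioc y x ×ˢ Ioi (x - y)) := by
    rw [measureReal_prod_prod, h3]
  rw [conv_real_Ioi, e2, e3]
  nth_rewrite 1 [e1]
  rw [← measureReal_union, ← measureReal_union]
  · refine measureReal_mono ?_ (measure_ne_top _ _)
    rintro ⟨p, q⟩ h
    simp only [mem_union, mem_prod, mem_Ioi, mem_Ici, mem_Icc, mem_Ioc, mem_ofPred_eq] at h ⊢
    rcases h with (h | h) | h <;> linarith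
  · rw [Set.disjoint_left]
    rintro ⟨p, q⟩ h h'
    simp only [mem_union, mem_prod, mem_Ioi, mem_Ici, mem_Icc, mem_Ioc] at h h'
    rcases h with h | h <;> linarith
  · exact measurableSet_Ioc.prod measurableSet_Ioi
  · rw [Set.disjoint_left]
    rintro ⟨p, q⟩ h h'
    simp only [mem_prod, mem_Ioi, mem_Ici, mem_Icc] at h h'
    linarith
  · exact measurableSet_Icc.prod measurableSet_Ioi

/-- After division by the tail at `x`, the convolution is `2 + o(1)`, and `conv_ge` leaves at most
`ν(y, ∞) + o(1)` for `(ν(y, ∞) - ν(x, ∞))` times the ratio. This squeezes the ratio to `1`. -/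
theorem tendsto_shift_of_nonneg {y : ℝ} (hy : 0 ≤ y) :
    Tendsto (fun x => ν.real (Ioi (x - y)) / ν.real (Ioi x)) atTop (𝓝 1) := by
  have := hν.prob
  have hz := tendsto_real_Ioi_zero ν
  have hup : Tendsto (fun x => ((Measure.conv ν ν).real (Ioi x) / ν.real (Ioi x) - 2
      + ν.real (Ioi y)) / (ν.real (Ioi y) - ν.real (Ioi x))) atTop (𝓝 1) := by
    have h := ((hν.tendsto_conv.sub_const 2).add_const (ν.real (Ioi y))).div
      (tendsto_const_nhds.sub hz) (by simpa using (hν.real_pos y).ne')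
    rwa [sub_self, zero_add, sub_zero, div_self (hν.real_pos y).ne'] at h
  refine tendsto_of_tendsto_of_tendsto_of_le_of_le' tendsto_const_nhds hup ?_ ?_
  · refine Eventually.of_forall fun x => ?_
    rw [le_div_iff₀ (hν.real_pos x), one_mul]
    exact antitone_real_Ioi ν (by linarith)
  · filter_upwards [eventually_gt_atTop y, hz.eventually (gt_mem_nhds (hν.real_pos y))] with x hx hx'
    have h := hν.conv_ge hx
    have hp := hν.real_pos x
    rw [le_div_iff₀ (by linarith), div_mul_eq_mul_div, div_le_iff₀ hp]
    have : (Measure.conv ν ν).real (Ioi x) / ν.real (Ioi x) * ν.real (Ioi x)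
        = (Measure.conv ν ν).real (Ioi x) := div_mul_cancel₀ _ hp.ne'
    nlinarith [h, this]

/-- Subexponential laws are long-tailed. -/
theorem tendsto_shift (y : ℝ) :
    Tendsto (fun x => ν.real (Ioi (x + y)) / ν.real (Ioi x)) atTop (𝓝 1) := by
  rcases le_total 0 y with hy | hy
  · have h := ((hν.tendsto_shift_of_nonneg hy).comp (tendsto_atTop_add_const_right _ y tendsto_id)).inv₀
      one_ne_zero
    simpa [Function.comp_def] using h
  · simpa using hν.tendsto_shift_of_nonneg (y := -y) (by linarith)

/-- The event that one coordinate is in `[0, T]` and the other above `x` already accounts for almost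
two tails when `T` is large. Subexponentiality leaves nothing of first order for two simultaneously
large terms. -/
theorem bothLarge_le {T x : ℝ} (hx : T < x) :
    (ν.prod ν).real (bothLarge T x) ≤
      (Measure.conv ν ν).real (Ioi x) - 2 * (1 - ν.real (Ioi T)) * ν.real (Ioi x) := by
  have := hν.prob
  have e2 : (1 - ν.real (Ioi T)) * ν.real (Ioi x) = (ν.prod ν).real (Icc 0 T ×ˢ Ioi x) := by
    rw [measureReal_prod_prod, hν.real_Icc]
  have e3 : (1 - ν.real (Ioi T)) * ν.real (Ioi x) = (ν.prod ν).real (Ioi x ×ˢ Icc 0 T) := by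
    rw [measureReal_prod_prod, hν.real_Icc, mul_comm]
  have h : (ν.prod ν).real (bothLarge T x) + (ν.prod ν).real (Icc 0 T ×ˢ Ioi x)
      + (ν.prod ν).real (Ioi x ×ˢ Icc 0 T) ≤ (ν.prod ν).real {p : ℝ × ℝ | x < p.1 + p.2} := by
    rw [← measureReal_union, ← measureReal_union]
    · refine measureReal_mono ?_ (measure_ne_top _ _)
      rintro ⟨p, q⟩ h
      simp only [bothLarge, mem_union, mem_prod, mem_Ioi, mem_Icc, mem_ofPred_eq] at h ⊢
      rcases h with (h | h) | h <;> linarith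
    · rw [Set.disjoint_left]
      rintro ⟨p, q⟩ h h'
      simp only [bothLarge, mem_union, mem_prod, mem_Ioi, mem_Icc, mem_ofPred_eq] at h h'
      rcases h with h | h <;> linarith
    · exact measurableSet_Ioi.prod measurableSet_Icc
    · rw [Set.disjoint_left]
      rintro ⟨p, q⟩ h h'
      simp only [bothLarge, mem_prod, mem_Ioi, mem_Icc, mem_ofPred_eq] at h h'
      linarith
    · exact measurableSet_Icc.prod measurableSet_Ioi
  rw [conv_real_Ioi]
  linarith

theorem exists_bothLarge_le {ε : ℝ} (hε : 0 < ε) :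
    ∀ᶠ T in atTop, ∀ᶠ x in atTop, (ν.prod ν).real (bothLarge T x) ≤ ε * ν.real (Ioi x) := by
  have := hν.prob
  filter_upwards [(tendsto_real_Ioi_zero ν).eventually (gt_mem_nhds (show 0 < ε / 4 by linarith))]
    with T hT
  filter_upwards [eventually_gt_atTop T,
    hν.tendsto_conv.eventually (gt_mem_nhds (show (2 : ℝ) < 2 + ε / 2 by linarith))] with x hx h2
  rw [div_lt_iff₀ (hν.real_pos x)] at h2
  have h := hν.bothLarge_le hx
  have hp := hν.real_pos x
  nlinarith

theorem eventually_shift_le (T : ℝ) {c : ℝ} (hc : 1 < c) :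
    ∀ᶠ x in atTop, ν.real (Ioi (x - T)) ≤ c * ν.real (Ioi x) := by
  filter_upwards [(hν.tendsto_shift (-T)).eventually (gt_mem_nhds hc)] with x hx
  rw [div_lt_iff₀ (hν.real_pos x)] at hx
  simpa [sub_eq_add_neg] using hx.le

end IsSubexpLaw

/-- For a fixed first coordinate above `T`, the section is a half-line starting at `max T (x - a) ≥
T`, so domination of tails beyond `T` is enough to replace one factor. Applied to each factor in
turn, it reduces the both-large event to `ν ⊗ ν`. -/
theorem prod_bothLarge_le {μ ρ ν : Measure ℝ} [SFinite ρ] [SFinite ν] {T : ℝ} {C : ℝ≥0∞}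
    (h : ∀ y, T ≤ y → ρ (Ioi y) ≤ C * ν (Ioi y)) (x : ℝ) :
    (μ.prod ρ) (bothLarge T x) ≤ C * (μ.prod ν) (bothLarge T x) := by
  rw [Measure.prod_apply (measurableSet_bothLarge T x),
    Measure.prod_apply (measurableSet_bothLarge T x),
    ← lintegral_const_mul _ (measurable_measure_prodMk_left (measurableSet_bothLarge T x))]
  refine lintegral_mono fun a => ?_
  by_cases ha : T < a
  · have e : Prod.mk a ⁻¹' bothLarge T x = Ioi (max T (x - a)) := by
      ext b
      simp only [bothLarge, mem_preimage, mem_ofPred_eq, mem_Ioi, max_lt_iff, ha, true_and,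
        sub_lt_iff_lt_add']
    simp only [e]
    exact h _ (le_max_left _ _)
  · have e : Prod.mk a ⁻¹' bothLarge T x = ∅ := by
      ext b; simp [bothLarge, ha]
    simp [e]

theorem bothLarge_swap (μ ρ : Measure ℝ) [SFinite μ] [SFinite ρ] (T x : ℝ) :
    (μ.prod ρ) (bothLarge T x) = (ρ.prod μ) (bothLarge T x) := by
  rw [← Measure.prod_swap, Measure.map_apply measurable_swap (measurableSet_bothLarge T x)]
  congr 1
  ext ⟨p, q⟩
  simp only [bothLarge, mem_preimage, mem_ofPred_eq, Prod.fst_swap, Prod.snd_swap, add_comm p q]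
  tauto

/-- The tail of a sum of independent variables: one of them is large, or both are. -/
theorem prod_sum_gt_le {μ ρ ν : Measure ℝ} [IsFiniteMeasure μ] [IsFiniteMeasure ρ]
    [IsFiniteMeasure ν] {T C C' : ℝ} (hC : 0 ≤ C) (hC' : 0 ≤ C')
    (hμ : ∀ y, T ≤ y → μ.real (Ioi y) ≤ C * ν.real (Ioi y))
    (hρ : ∀ y, T ≤ y → ρ.real (Ioi y) ≤ C' * ν.real (Ioi y)) (x : ℝ) :
    (μ.prod ρ).real {p : ℝ × ℝ | x < p.1 + p.2} ≤
      μ.real univ * ρ.real (Ioi (x - T)) + μ.real (Ioi (x - T)) * ρ.real univ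
        + C * C' * (ν.prod ν).real (bothLarge T x) := by
  have conv : ∀ (ρ : Measure ℝ) [IsFiniteMeasure ρ] (c y : ℝ), 0 ≤ c →
      ρ.real (Ioi y) ≤ c * ν.real (Ioi y) → ρ (Ioi y) ≤ ENNReal.ofReal c * ν (Ioi y) := by
    intro ρ _ c y hc h
    rw [← ofReal_measureReal (μ := ρ), ← ofReal_measureReal (μ := ν), ← ENNReal.ofReal_mul hc]
    exact ENNReal.ofReal_le_ofReal h
  have h3 : (μ.prod ρ).real (bothLarge T x) ≤ C * C' * (ν.prod ν).real (bothLarge T x) := by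
    have a1 := prod_bothLarge_le (μ := μ) (fun y hy => conv ρ C' y hC' (hρ y hy)) x
    have a2 := prod_bothLarge_le (μ := ν) (fun y hy => conv μ C y hC (hμ y hy)) x
    rw [bothLarge_swap ν μ] at a2
    have a3 := a1.trans (mul_le_mul_right a2 _)
    have a4 := ENNReal.toReal_mono (by finiteness) a3
    simp only [ENNReal.toReal_mul, ENNReal.toReal_ofReal hC, ENNReal.toReal_ofReal hC'] at a4
    calc _ ≤ _ := a4
      _ = _ := by simp only [Measure.real]; ring
  have hsub : {p : ℝ × ℝ | x < p.1 + p.2} ⊆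
      (univ ×ˢ Ioi (x - T) ∪ Ioi (x - T) ×ˢ univ) ∪ bothLarge T x := by
    rintro ⟨p, q⟩ h
    simp only [bothLarge, mem_union, mem_prod, mem_univ, true_and, and_true, mem_Ioi,
      mem_ofPred_eq] at h ⊢
    by_cases h1 : T < p
    · by_cases h2 : T < q
      · exact Or.inr ⟨h1, h2, h⟩
      · exact Or.inl (Or.inr (by linarith))
    · exact Or.inl (Or.inl (by linarith))
  calc (μ.prod ρ).real {p : ℝ × ℝ | x < p.1 + p.2}
      ≤ _ := measureReal_mono hsub
    _ ≤ _ := measureReal_union_le _ _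
    _ ≤ _ := add_le_add (measureReal_union_le _ _) h3
    _ = _ := by rw [measureReal_prod_prod, measureReal_prod_prod]

/-! ### Defective renewal inequalities -/

/-- The tails of laws `ρ n` satisfying a defective renewal inequality are uniformly dominated by
the tail of a subexponential law. -/
theorem IsSubexpLaw.exists_uniform_bound {ν : Measure ℝ} (hν : IsSubexpLaw ν) {μ : Measure ℝ}
    [IsFiniteMeasure μ] {ρ : ℕ → Measure ℝ} [∀ n, IsProbabilityMeasure (ρ n)] {r C : ℝ}
    (hC : 0 ≤ C) (hγ : μ.real univ < 1)
    (hμ : ∀ᶠ x in atTop, μ.real (Ioi x) ≤ C * ν.real (Ioi x))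
    (h0 : ∀ x, 0 ≤ x → (ρ 0).real (Ioi x) = 0)
    (hrec : ∀ n x, r ≤ x → (ρ (n + 1)).real (Ioi x) ≤
      (μ.prod (ρ n)).real {p : ℝ × ℝ | x < p.1 + p.2}) :
    ∃ K, 0 ≤ K ∧ ∀ x n, (ρ n).real (Ioi x) ≤ K * ν.real (Ioi x) := by
  have := hν.prob
  set γ := μ.real univ with hγdef
  have hγ0 : 0 ≤ γ := measureReal_nonneg
  -- Each induction step multiplies the constant by at most `γ + 2η`: one `η` pays for the shift by
  -- `T`, the other for the both-large event.
  obtain ⟨η, hη, hηγ⟩ : ∃ η : ℝ, 0 < η ∧ γ + 2 * η < 1 := ⟨(1 - γ) / 4, by linarith, by linarith⟩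
  obtain ⟨x₁, hx₁⟩ := eventually_atTop.1 hμ
  obtain ⟨T, hT, hTx⟩ := ((hν.exists_bothLarge_le (show 0 < η / (C + 1) by positivity)).and
    (eventually_ge_atTop x₁)).exists
  obtain ⟨x₀, hx₀⟩ := eventually_atTop.1 (((hT.and
    (hν.eventually_shift_le T (show 1 < 1 + η by linarith))).and (eventually_ge_atTop r)).and
    ((eventually_ge_atTop (x₁ + T)).and (eventually_ge_atTop 0)))
  have hp := hν.real_pos x₀
  -- The first entry makes the bound trivial for `x ≤ x₀`; the second makes `K` stable under the
  -- recursion `K ↦ (γ + 2η) K + C (1 + η)`.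
  set K := max (1 / ν.real (Ioi x₀)) (C * (1 + η) / (1 - γ - 2 * η)) with hK
  have hK1 : 1 ≤ K * ν.real (Ioi x₀) := by
    rw [← div_le_iff₀ hp]; exact le_max_left _ _
  have hK2 : C * (1 + η) ≤ K * (1 - γ - 2 * η) := by
    rw [← div_le_iff₀ (by linarith)]; exact le_max_right _ _
  have hK0 : 0 ≤ K := le_trans (by positivity) (le_max_left _ _)
  refine ⟨K, hK0, ?_⟩
  have small : ∀ x n, x ≤ x₀ → (ρ n).real (Ioi x) ≤ K * ν.real (Ioi x) := fun x n hx =>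
    (measureReal_le_one).trans
      (hK1.trans (mul_le_mul_of_nonneg_left (antitone_real_Ioi ν hx) hK0))
  intro x n
  induction n generalizing x with
  | zero =>
    rcases le_total x x₀ with hx | hx
    · exact small x 0 hx
    · rw [h0 x ((hx₀ x₀ le_rfl).2.2.trans hx)]
      exact mul_nonneg hK0 measureReal_nonneg
  | succ n ih =>
    rcases le_total x x₀ with hx | hx
    · exact small x _ hx
    obtain ⟨⟨⟨h1, h2⟩, h3⟩, h4, -⟩ := hx₀ x hx
    have hs := prod_sum_gt_le (μ := μ) (ρ := ρ n) (ν := ν) (T := T) hC hK0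
      (fun y hy => hx₁ y (hTx.trans hy)) (fun y _ => ih y) x
    rw [probReal_univ (μ := ρ n), mul_one] at hs
    have hG := hν.real_pos x
    have e1 : γ * (ρ n).real (Ioi (x - T)) ≤ γ * (K * ((1 + η) * ν.real (Ioi x))) := by
      gcongr
      exact (ih _).trans (by gcongr)
    have e2 : μ.real (Ioi (x - T)) ≤ C * ((1 + η) * ν.real (Ioi x)) :=
      (hx₁ _ (by linarith)).trans (by gcongr)
    have e3 : C * K * (ν.prod ν).real (bothLarge T x) ≤ K * (η * ν.real (Ioi x)) := by
      calc _ ≤ C * K * (η / (C + 1) * ν.real (Ioi x)) := by gcongr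
        _ = K * (η * ν.real (Ioi x)) * (C / (C + 1)) := by ring
        _ ≤ K * (η * ν.real (Ioi x)) * 1 := by
          gcongr
          rw [div_le_one (by positivity)]; linarith
        _ = _ := mul_one _
    have e4 : C * (1 + η) * ν.real (Ioi x) ≤ K * (1 - γ - 2 * η) * ν.real (Ioi x) := by gcongr
    have e5 : γ * η * (K * ν.real (Ioi x)) ≤ 1 * η * (K * ν.real (Ioi x)) := by gcongr
    have := (hrec n x h3).trans hs
    linarith

/-- One pass through the renewal inequality: either the `ρ`-term is large, at cost `γ K`, or the
`μ`-term is, at cost `m`; both being large is negligible. The threshold in `x` does not depend on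
`n`. -/
theorem IsSubexpLaw.improve_bound {ν : Measure ℝ} (hν : IsSubexpLaw ν) {μ : Measure ℝ}
    [IsFiniteMeasure μ] {ρ : ℕ → Measure ℝ} [∀ n, IsProbabilityMeasure (ρ n)] {m K K' : ℝ}
    (hm : 0 ≤ m) (hK : 0 ≤ K)
    (hμ : ∀ m' > m, ∀ᶠ x in atTop, μ.real (Ioi x) ≤ m' * ν.real (Ioi x))
    (hρ : ∀ᶠ x in atTop, ∀ n, (ρ n).real (Ioi x) ≤ K * ν.real (Ioi x))
    (hK' : μ.real univ * K + m < K') :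
    ∀ᶠ x in atTop, ∀ n, (μ.prod (ρ n)).real {p : ℝ × ℝ | x < p.1 + p.2} ≤
      K' * ν.real (Ioi x) := by
  have := hν.prob
  set γ := μ.real univ with hγdef
  have hγ0 : 0 ≤ γ := measureReal_nonneg
  obtain ⟨η, hηK, hη⟩ : ∃ η : ℝ,
      γ * K * (1 + η) + (m + η) * (1 + η) + (m + 1) * K * η < K' ∧ 0 < η := by
    have hc : Tendsto (fun η : ℝ => γ * K * (1 + η) + (m + η) * (1 + η) + (m + 1) * K * η)
        (𝓝[>] 0) (𝓝 (γ * K * (1 + 0) + (m + 0) * (1 + 0) + (m + 1) * K * 0)) :=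
      (Continuous.tendsto (by fun_prop) 0).mono_left nhdsWithin_le_nhds
    exact ((hc.eventually (gt_mem_nhds (by linarith))).and self_mem_nhdsWithin).exists
  obtain ⟨x₁, hx₁⟩ := eventually_atTop.1 ((hμ (m + 1) (by linarith)).and hρ)
  obtain ⟨T, hT, hTx⟩ := ((hν.exists_bothLarge_le hη).and (eventually_ge_atTop x₁)).exists
  have hsh : Tendsto (fun x : ℝ => x - T) atTop atTop := tendsto_atTop_add_const_right _ (-T) tendsto_id
  filter_upwards [hT, hν.eventually_shift_le T (show 1 < 1 + η by linarith),
    hsh.eventually (hμ (m + η) (by linarith)), hsh.eventually hρ] with x h1 h2 h3 h4 n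
  have hs := prod_sum_gt_le (μ := μ) (ρ := ρ n) (ν := ν) (T := T) (show 0 ≤ m + 1 by linarith) hK
    (fun y hy => (hx₁ y (hTx.trans hy)).1) (fun y hy => (hx₁ y (hTx.trans hy)).2 n) x
  rw [probReal_univ (μ := ρ n), mul_one] at hs
  have hG := hν.real_pos x
  have e1 : γ * (ρ n).real (Ioi (x - T)) ≤ γ * (K * ((1 + η) * ν.real (Ioi x))) := by
    gcongr
    exact (h4 n).trans (by gcongr)
  have e2 : μ.real (Ioi (x - T)) ≤ (m + η) * ((1 + η) * ν.real (Ioi x)) :=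
    h3.trans (by gcongr)
  have e3 : (m + 1) * K * (ν.prod ν).real (bothLarge T x) ≤
      (m + 1) * K * (η * ν.real (Ioi x)) := by gcongr
  have e4 := mul_le_mul_of_nonneg_right hηK.le hG.le
  linarith

/-- Sharp uniform tail asymptotics from a defective renewal inequality. -/
theorem IsSubexpLaw.eventually_le_of_renewal {ν : Measure ℝ} (hν : IsSubexpLaw ν) {μ : Measure ℝ}
    [IsFiniteMeasure μ] {ρ : ℕ → Measure ℝ} [∀ n, IsProbabilityMeasure (ρ n)] {r m : ℝ}
    (hm : 0 ≤ m) (hγ : μ.real univ < 1)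
    (hμ : ∀ m' > m, ∀ᶠ x in atTop, μ.real (Ioi x) ≤ m' * ν.real (Ioi x))
    (h0 : ∀ x, 0 ≤ x → (ρ 0).real (Ioi x) = 0)
    (hrec : ∀ n x, r ≤ x → (ρ (n + 1)).real (Ioi x) ≤
      (μ.prod (ρ n)).real {p : ℝ × ℝ | x < p.1 + p.2})
    {h : ℝ} (hh : m / (1 - μ.real univ) < h) :
    ∀ᶠ x in atTop, ∀ n, (ρ n).real (Ioi x) ≤ h * ν.real (Ioi x) := by
  have hγ0 : 0 ≤ μ.real univ := measureReal_nonneg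
  set S : Set ℝ := {K | 0 ≤ K ∧ ∀ᶠ x in atTop, ∀ n, (ρ n).real (Ioi x) ≤ K * ν.real (Ioi x)}
    with hS
  have hne : S.Nonempty := by
    obtain ⟨K, hK, h⟩ := hν.exists_uniform_bound (show 0 ≤ m + 1 by linarith) hγ
      (hμ (m + 1) (by linarith)) h0 hrec
    exact ⟨K, hK, Eventually.of_forall h⟩
  have hbdd : BddBelow S := ⟨0, fun K hK => hK.1⟩
  -- The set of admissible constants is stable, up to arbitrarily small error, under `K ↦ γ K + m`.
  -- Its infimum is therefore at most the fixed point `m / (1 - γ)`.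
  have key : ∀ K ∈ S, sInf S ≤ μ.real univ * K + m := by
    intro K hK
    refine le_of_forall_gt_imp_ge_of_dense fun K' hK' => csInf_le hbdd ⟨?_, ?_⟩
    · exact le_trans (by have := mul_nonneg hγ0 hK.1; linarith) hK'.le
    · have hpos : 0 ≤ K' := le_trans (by have := mul_nonneg hγ0 hK.1; linarith) hK'.le
      filter_upwards [hν.improve_bound hm hK.1 hμ hK.2 hK', eventually_ge_atTop r,
        eventually_ge_atTop 0] with x hx hr hx0 n
      cases n with
      | zero => rw [h0 x hx0]; exact mul_nonneg hpos measureReal_nonneg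
      | succ n => exact (hrec n x hr).trans (hx n)
  have hle : sInf S ≤ m / (1 - μ.real univ) := by
    rw [le_div_iff₀ (by linarith)]
    have : ∀ δ > 0, sInf S ≤ μ.real univ * sInf S + m + δ := by
      intro δ hδ
      obtain ⟨K, hK, hKlt⟩ := exists_lt_of_csInf_lt hne (show sInf S < sInf S + δ by linarith)
      have := key K hK
      nlinarith
    have := le_of_forall_pos_le_add this
    linarith
  obtain ⟨K, hK, hKlt⟩ := exists_lt_of_csInf_lt hne (hle.trans_lt hh)
  filter_upwards [hK.2] with x hx n
  exact (hx n).trans (mul_le_mul_of_nonneg_right hKlt.le measureReal_nonneg)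

/-! ### The tandem walk and its subadditivity -/

/-- The random walk with increments `Y k - A k`. -/
noncomputable def walk (A Y : ℕ → ℝ) (n : ℕ) : ℝ := ∑ k ∈ Finset.range n, (Y k - A k)

/-- The largest weight of a path of length `n` that collects increments `Y k - A k` up to some
index and increments `X k - A k` from then on. -/
noncomputable def tandemWalk (A X Y : ℕ → ℝ) : ℕ → ℝ
  | 0 => 0
  | n + 1 => max (tandemWalk A X Y n + (X n - A n)) (walk A Y (n + 1))

/-- The running maximum of `tandemWalk`. -/
noncomputable def tandemMax (A X Y : ℕ → ℝ) : ℕ → ℝ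
  | 0 => 0
  | n + 1 => max (tandemMax A X Y n) (tandemWalk A X Y (n + 1))

theorem walk_succ (A Y : ℕ → ℝ) (n : ℕ) : walk A Y (n + 1) = walk A Y n + (Y n - A n) :=
  Finset.sum_range_succ _ _

theorem walk_zero (A Y : ℕ → ℝ) : walk A Y 0 = 0 := rfl

theorem walk_le_tandemWalk (A X Y : ℕ → ℝ) (n : ℕ) : walk A Y n ≤ tandemWalk A X Y n := by
  cases n with
  | zero => exact le_rfl
  | succ n => exact le_max_right _ _

theorem tandemWalk_le_tandemMax (A X Y : ℕ → ℝ) {j n : ℕ} (h : j ≤ n) :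
    tandemWalk A X Y j ≤ tandemMax A X Y n := by
  induction n with
  | zero => obtain rfl : j = 0 := by omega
            exact le_rfl
  | succ n ih =>
    rcases Nat.lt_or_ge j (n + 1) with hj | hj
    · exact (ih (by omega)).trans (le_max_left _ _)
    · obtain rfl : j = n + 1 := by omega
      exact le_max_right _ _

theorem exists_of_lt_tandemMax {A X Y : ℕ → ℝ} {n : ℕ} {x : ℝ} (h : x < tandemMax A X Y n) :
    ∃ j ≤ n, x < tandemWalk A X Y j := by
  induction n with
  | zero => exact ⟨0, le_rfl, h⟩
  | succ n ih =>
    rcases lt_max_iff.1 h with h | h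
    · obtain ⟨j, hj, hx⟩ := ih h
      exact ⟨j, by omega, hx⟩
    · exact ⟨n + 1, le_rfl, h⟩

theorem walk_add (A Y : ℕ → ℝ) (k j : ℕ) :
    walk A Y (k + j) = walk A Y k + walk (fun i => A (k + i)) (fun i => Y (k + i)) j :=
  Finset.sum_range_add _ _ _

/-- Cutting a path at time `k` gives two admissible paths. Only an inequality holds, since gluing
two optimal pieces might return from `X` to `Y`. -/
theorem tandemWalk_add_le (A X Y : ℕ → ℝ) (k j : ℕ) :
    tandemWalk A X Y (k + j) ≤ tandemWalk A X Y k +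
      tandemWalk (fun i => A (k + i)) (fun i => X (k + i)) (fun i => Y (k + i)) j := by
  induction j with
  | zero => simp [tandemWalk]
  | succ j ih =>
    rw [← add_assoc, tandemWalk, tandemWalk, max_le_iff]
    constructor
    · refine le_trans ?_ (add_le_add_right (le_max_left _ _) _)
      linarith
    · refine le_trans ?_ (add_le_add_right (le_max_right _ _) _)
      rw [add_assoc, walk_add]
      exact add_le_add_left (walk_le_tandemWalk A X Y k) _

section Measurability

variable {Ω : Type*} {m : MeasurableSpace Ω} {A X Y : ℕ → Ω → ℝ} {n : ℕ}

theorem measurable_walk (hA : ∀ k < n, Measurable (A k)) (hY : ∀ k < n, Measurable (Y k)) :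
    Measurable fun ω => walk (fun k => A k ω) (fun k => Y k ω) n :=
  Finset.measurable_fun_sum _ fun k hk =>
    (hY k (Finset.mem_range.1 hk)).sub (hA k (Finset.mem_range.1 hk))

theorem measurable_tandemWalk (hA : ∀ k < n, Measurable (A k)) (hX : ∀ k < n, Measurable (X k))
    (hY : ∀ k < n, Measurable (Y k)) :
    Measurable fun ω => tandemWalk (fun k => A k ω) (fun k => X k ω) (fun k => Y k ω) n := by
  induction n with
  | zero => exact measurable_const
  | succ n ih =>
    have ih := ih (fun k hk => hA k (by omega)) (fun k hk => hX k (by omega))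
      (fun k hk => hY k (by omega))
    exact (ih.add ((hX n (by omega)).sub (hA n (by omega)))).max (measurable_walk hA hY)

theorem measurable_tandemMax (hA : ∀ k < n, Measurable (A k)) (hX : ∀ k < n, Measurable (X k))
    (hY : ∀ k < n, Measurable (Y k)) :
    Measurable fun ω => tandemMax (fun k => A k ω) (fun k => X k ω) (fun k => Y k ω) n := by
  induction n with
  | zero => exact measurable_const
  | succ n ih =>
    have ih := ih (fun k hk => hA k (by omega)) (fun k hk => hX k (by omega))
      (fun k hk => hY k (by omega))
    exact ih.max (measurable_tandemWalk hA hX hY)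

end Measurability

/-! ### Renewal at the first barrier crossing -/

theorem ProbabilityTheory.Indep.map_restrict_prodMk {Ω : Type*} {m₁ m₂ mΩ : MeasurableSpace Ω} {P : Measure Ω}
    [IsProbabilityMeasure P] (h₁ : m₁ ≤ mΩ) (h₂ : m₂ ≤ mΩ)
    (h : Indep m₁ m₂ P) {S : Set Ω} (hS : MeasurableSet[m₁] S) {f g : Ω → ℝ}
    (hf : Measurable[m₁] f) (hg : Measurable[m₂] g) :
    (P.restrict S).map (fun ω => (f ω, g ω)) = ((P.restrict S).map f).prod (P.map g) := by
  have hf' : Measurable f := hf.mono h₁ le_rfl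
  have hg' : Measurable g := hg.mono h₂ le_rfl
  symm
  have : IsProbabilityMeasure (P.map g) := Measure.isProbabilityMeasure_map hg'.aemeasurable
  refine Measure.prod_eq fun s t hs ht => ?_
  rw [Measure.map_apply (hf'.prodMk hg') (hs.prod ht), Measure.map_apply hf' hs,
    Measure.map_apply hg' ht, Measure.restrict_apply (hf'.prodMk hg' (hs.prod ht)),
    Measure.restrict_apply (hf' hs), ← (Indep_iff _ _ _).1 h _ _ ((hf hs).inter hS) (hg ht)]
  congr 1
  ext ω
  simp only [mem_inter_iff, mem_preimage, mem_prod]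
  tauto

theorem mem_disjointed_nat {Ω : Type*} {E : ℕ → Set Ω} {k : ℕ} {ω : Ω} :
    ω ∈ disjointed E k ↔ ω ∈ E k ∧ ∀ j < k, ω ∉ E j := by
  simp [disjointed_eq_inter_compl]

section Renewal

variable {Ω : Type*} [MeasurableSpace Ω] {P : Measure Ω} {A X Y : ℕ → Ω → ℝ}

/-- One of the two walks is above its barrier at time `k`. -/
def exceeds (A X Y : ℕ → Ω → ℝ) (r c c₂ : ℝ) (k : ℕ) : Set Ω :=
  {ω | r - k * c₂ < walk (fun k => A k ω) (fun k => Y k ω) k} ∪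
    {ω | r - k * c < tandemWalk (fun k => A k ω) (fun k => X k ω) (fun k => Y k ω) k}

/-- The law of `tandemWalk` at the first time when a barrier is exceeded. -/
noncomputable def overshootLaw (P : Measure Ω) (A X Y : ℕ → Ω → ℝ) (r c c₂ : ℝ) : Measure ℝ :=
  Measure.sum fun k => (P.restrict (disjointed (exceeds A X Y r c c₂) k)).map
    fun ω => tandemWalk (fun k => A k ω) (fun k => X k ω) (fun k => Y k ω) k

/-- Stated for an arbitrary σ-algebra so that it applies to the one generated by the first `n`
variables: the crossing time is a stopping time. -/
theorem measurableSet_disjointed_exceeds {Ω : Type*} {m : MeasurableSpace Ω} {A X Y : ℕ → Ω → ℝ} {r c c₂ : ℝ} {n : ℕ}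
    (hA : ∀ k < n, Measurable[m] (A k)) (hX : ∀ k < n, Measurable[m] (X k))
    (hY : ∀ k < n, Measurable[m] (Y k)) :
    MeasurableSet[m] (disjointed (exceeds A X Y r c c₂) n) := by
  have h : ∀ k ≤ n, MeasurableSet[m] (exceeds A X Y r c c₂ k) := fun k hk =>
    (measurableSet_lt measurable_const
        (measurable_walk (fun i hi => hA i (by omega)) (fun i hi => hY i (by omega)))).union
      (measurableSet_lt measurable_const
        (measurable_tandemWalk (fun i hi => hA i (by omega)) (fun i hi => hX i (by omega))
          (fun i hi => hY i (by omega))))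
  rw [disjointed_eq_inter_compl]
  exact (h n le_rfl).inter (MeasurableSet.biInter (to_countable _) fun j hj =>
    (h j (le_of_lt hj)).compl)

theorem overshootLaw_univ (hA : ∀ k, Measurable (A k)) (hX : ∀ k, Measurable (X k))
    (hY : ∀ k, Measurable (Y k)) (r c c₂ : ℝ) :
    overshootLaw P A X Y r c c₂ univ = P (⋃ k, exceeds A X Y r c c₂ k) := by
  rw [← iUnion_disjointed, measure_iUnion (disjoint_disjointed _) fun k =>
    measurableSet_disjointed_exceeds (fun i _ => hA i) (fun i _ => hX i) (fun i _ => hY i),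
    overshootLaw, Measure.sum_apply _ MeasurableSet.univ]
  congr 1
  ext k
  rw [Measure.map_apply (measurable_tandemWalk (fun i _ => hA i) (fun i _ => hX i) (fun i _ => hY i))
    MeasurableSet.univ, preimage_univ, Measure.restrict_apply_univ]

theorem isFiniteMeasure_overshootLaw [IsFiniteMeasure P] (hA : ∀ k, Measurable (A k)) (hX : ∀ k, Measurable (X k))
    (hY : ∀ k, Measurable (Y k)) (r c c₂ : ℝ) :
    IsFiniteMeasure (overshootLaw P A X Y r c c₂) :=
  ⟨by rw [overshootLaw_univ hA hX hY]; exact measure_lt_top _ _⟩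

/-- If the first crossing is at time `k + 1`, both walks were below their barriers at time `k`. To
end above `x`, the next increment must bridge the gap alone, so `X k > x - r + k c` or `Y k > x - r
+ k c₂`. The barrier for the pure `Y`-walk is what allows the steeper slope `c₂` in the second term.
-/
theorem overshootLaw_Ioi_le (hA : ∀ k, Measurable (A k)) (hX : ∀ k, Measurable (X k))
    (hY : ∀ k, Measurable (Y k)) (hA0 : ∀ k, ∀ᵐ ω ∂P, 0 ≤ A k ω) {r : ℝ} (hr : 0 ≤ r)
    (c c₂ x : ℝ) :
    overshootLaw P A X Y r c c₂ (Ioi x) ≤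
      ∑' k : ℕ, P {ω | x - r + k * c < X k ω} + ∑' k : ℕ, P {ω | x - r + k * c₂ < Y k ω} := by
  rw [overshootLaw, Measure.sum_apply _ measurableSet_Ioi, tsum_eq_zero_add' ENNReal.summable,
    ← ENNReal.tsum_add]
  have hm : ∀ k, Measurable fun ω =>
      tandemWalk (fun k => A k ω) (fun k => X k ω) (fun k => Y k ω) k := fun k =>
    measurable_tandemWalk (fun i _ => hA i) (fun i _ => hX i) (fun i _ => hY i)
  -- At time `0` both walks vanish and `r ≥ 0`, so there is no crossing; the sum starts at time `1`.
  have e0 : disjointed (exceeds A X Y r c c₂) 0 = ∅ := by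
    ext ω
    simp [exceeds, walk_zero, tandemWalk, hr]
  rw [e0, Measure.restrict_empty, Measure.map_zero, Measure.coe_zero, Pi.zero_apply, zero_add]
  refine ENNReal.tsum_le_tsum fun k => ?_
  rw [Measure.map_apply (hm _) measurableSet_Ioi,
    Measure.restrict_apply (hm _ measurableSet_Ioi)]
  refine le_trans (measure_mono_ae ?_) (measure_union_le _ _)
  filter_upwards [hA0 k] with ω h0 hω
  obtain ⟨h1, h2⟩ := hω
  have h3 := (mem_disjointed_nat.1 h2).2 k (Nat.lt_succ_self k)
  simp only [exceeds, mem_union, mem_ofPred_eq, not_or, not_lt] at h3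
  simp only [mem_preimage, mem_Ioi, tandemWalk, walk_succ, lt_max_iff] at h1
  change x - r + k * c < X k ω ∨ x - r + k * c₂ < Y k ω
  rcases h1 with h1 | h1
  · left; linarith
  · right; linarith

theorem map_tandemMax_shift [IsProbabilityMeasure P]
    (h_indep : iIndepFun (Sum.elim A (Sum.elim X Y)) P)
    (hA_ident : ∀ n, IdentDistrib (A n) (A 0) P P) (hX_ident : ∀ n, IdentDistrib (X n) (X 0) P P)
    (hY_ident : ∀ n, IdentDistrib (Y n) (Y 0) P P) (k n : ℕ) :
    P.map (fun ω => tandemMax (fun i => A (k + i) ω) (fun i => X (k + i) ω)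
      (fun i => Y (k + i) ω) n) =
    P.map (fun ω => tandemMax (fun i => A i ω) (fun i => X i ω) (fun i => Y i ω) n) := by
  have hinj : Function.Injective
      (Sum.map (k + ·) (Sum.map (k + ·) (k + ·)) : ℕ ⊕ ℕ ⊕ ℕ → ℕ ⊕ ℕ ⊕ ℕ) := by
    have := add_right_injective k
    exact this.sumMap (this.sumMap this)
  have h := IdentDistrib.pi (μ := P) (ν := P)
    (X := fun i => Sum.elim A (Sum.elim X Y) (Sum.map (k + ·) (Sum.map (k + ·) (k + ·)) i))
    (Y := Sum.elim A (Sum.elim X Y)) ?_ (h_indep.precomp hinj) h_indep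
  · have hm : Measurable fun w : ℕ ⊕ ℕ ⊕ ℕ → ℝ => tandemMax (fun i => w (Sum.inl i))
        (fun i => w (Sum.inr (Sum.inl i))) (fun i => w (Sum.inr (Sum.inr i))) n :=
      measurable_tandemMax (A := fun i (w : ℕ ⊕ ℕ ⊕ ℕ → ℝ) => w (Sum.inl i))
        (X := fun i w => w (Sum.inr (Sum.inl i))) (Y := fun i w => w (Sum.inr (Sum.inr i))) (fun _ _ => by fun_prop) (fun _ _ => by fun_prop)
        (fun _ _ => by fun_prop)
    exact (h.comp hm).map_eq
  · rintro (i | i | i)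
    · exact (hA_ident _).trans (hA_ident i).symm
    · exact (hX_ident _).trans (hX_ident i).symm
    · exact (hY_ident _).trans (hY_ident i).symm

/-- As `x ≥ r` and `c ≥ 0`, a running maximum above `x` forces a crossing. At the first crossing
time `N`, subadditivity bounds the later walk by its value at `N` plus a shifted maximum, which is
independent of the past and has the original law. -/
theorem renewal_inequality [IsProbabilityMeasure P] (hA : ∀ k, Measurable (A k)) (hX : ∀ k, Measurable (X k))
    (hY : ∀ k, Measurable (Y k)) (h_indep : iIndepFun (Sum.elim A (Sum.elim X Y)) P)
    (hA_ident : ∀ n, IdentDistrib (A n) (A 0) P P) (hX_ident : ∀ n, IdentDistrib (X n) (X 0) P P)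
    (hY_ident : ∀ n, IdentDistrib (Y n) (Y 0) P P) {r c x : ℝ} (hr : 0 ≤ r) (hc : 0 ≤ c) (c₂ : ℝ)
    (hx : r ≤ x) (n : ℕ) :
    P.map (fun ω => tandemMax (fun i => A i ω) (fun i => X i ω) (fun i => Y i ω) (n + 1)) (Ioi x) ≤
      ((overshootLaw P A X Y r c c₂).prod
        (P.map fun ω => tandemMax (fun i => A i ω) (fun i => X i ω) (fun i => Y i ω) n))
        {p | x < p.1 + p.2} := by
  set R : ℕ → Ω → ℝ := fun k ω => tandemWalk (fun k => A k ω) (fun k => X k ω) (fun k => Y k ω) k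
    with hR
  set Q : ℕ → Ω → ℝ := fun k ω => tandemMax (fun i => A (k + i) ω) (fun i => X (k + i) ω)
      (fun i => Y (k + i) ω) n with hQ
  set S := disjointed (exceeds A X Y r c c₂) with hS
  have hsub : {ω | x < tandemMax (fun i => A i ω) (fun i => X i ω) (fun i => Y i ω) (n + 1)} ⊆
      ⋃ k, (S k ∩ {ω | x < R k ω + Q k ω}) := by
    intro ω hω
    obtain ⟨j, hj, hjx⟩ := exists_of_lt_tandemMax hω
    have hjB : ω ∈ exceeds A X Y r c c₂ j := by
      refine Or.inr (lt_of_le_of_lt ?_ hjx)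
      have : 0 ≤ j * c := by positivity
      linarith
    classical
    have hex : ∃ k, ω ∈ exceeds A X Y r c c₂ k := ⟨j, hjB⟩
    have hN := Nat.find_spec hex
    have hNmin : ∀ i < Nat.find hex, ω ∉ exceeds A X Y r c c₂ i := fun i hi => Nat.find_min hex hi
    have hNj : Nat.find hex ≤ j := Nat.find_min' hex hjB
    set N := Nat.find hex
    -- `N ≥ 1` is what lowers the remaining horizon from `n + 1` to `n`.
    have hN0 : N ≠ 0 := by
      intro h0
      rw [h0] at hN
      simp only [exceeds, walk_zero, tandemWalk, Nat.cast_zero, zero_mul, sub_zero, mem_union,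
        mem_ofPred_eq, or_self] at hN
      linarith
    obtain ⟨j', rfl⟩ := Nat.exists_eq_add_of_le hNj
    refine mem_iUnion.2 ⟨N, mem_disjointed_nat.2 ⟨hN, hNmin⟩, ?_⟩
    change x < R N ω + Q N ω
    refine hjx.trans_le ((tandemWalk_add_le _ _ _ N j').trans (add_le_add_right ?_ _))
    exact tandemWalk_le_tandemMax _ _ _ (by omega)
  have hRm : ∀ k, Measurable (R k) := fun k =>
    measurable_tandemWalk (fun i _ => hA i) (fun i _ => hX i) (fun i _ => hY i)
  have hQm : ∀ k, Measurable (Q k) := fun k => measurable_tandemMax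
    (A := fun i => A (k + i)) (X := fun i => X (k + i)) (Y := fun i => Y (k + i))
    (fun i _ => hA _) (fun i _ => hX _) (fun i _ => hY _)
  have hterm : ∀ k, P (S k ∩ {ω | x < R k ω + Q k ω}) =
      (((P.restrict (S k)).map (R k)).prod (P.map (Q 0))) {p | x < p.1 + p.2} := by
    intro k
    set f := Sum.elim A (Sum.elim X Y) with hf
    have hfm : ∀ i, Measurable (f i) := by
      rintro (i | i | i)
      exacts [hA i, hX i, hY i]
    -- The past: all variables with index below `k`, which determine `S k` and `R k`. The shifted
    -- maximum `Q k` uses only the complement.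
    set I : Set (ℕ ⊕ ℕ ⊕ ℕ) := {i | Sum.elim id (Sum.elim id id) i < k} with hI
    have hle : ∀ i, MeasurableSpace.comap (f i) inferInstance ≤ ‹MeasurableSpace Ω› :=
      fun i => (hfm i).comap_le
    have hind := indep_iSup_of_disjoint hle h_indep.iIndep (disjoint_compl_right (a := I))
    have hmem : ∀ (J : Set (ℕ ⊕ ℕ ⊕ ℕ)), ∀ i ∈ J,
        Measurable[⨆ i ∈ J, MeasurableSpace.comap (f i) inferInstance] (f i) := fun J i hi =>
      (comap_measurable (f i)).mono (le_biSup (fun i => MeasurableSpace.comap (f i) _) hi) le_rfl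
    have e := Indep.map_restrict_prodMk (iSup₂_le fun i _ => hle i) (iSup₂_le fun i _ => hle i) hind
      (S := S k) (f := R k) (g := Q k)
      (measurableSet_disjointed_exceeds (fun i hi => hmem I (Sum.inl i) hi)
        (fun i hi => hmem I (Sum.inr (Sum.inl i)) hi) (fun i hi => hmem I (Sum.inr (Sum.inr i)) hi))
      (measurable_tandemWalk (fun i hi => hmem I (Sum.inl i) hi)
        (fun i hi => hmem I (Sum.inr (Sum.inl i)) hi) (fun i hi => hmem I (Sum.inr (Sum.inr i)) hi))
      (measurable_tandemMax
        (A := fun i => A (k + i)) (X := fun i => X (k + i)) (Y := fun i => Y (k + i))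
        (fun i _ => hmem Iᶜ (Sum.inl (k + i)) (by simp [hI]))
        (fun i _ => hmem Iᶜ (Sum.inr (Sum.inl (k + i))) (by simp [hI]))
        (fun i _ => hmem Iᶜ (Sum.inr (Sum.inr (k + i))) (by simp [hI])))
    have e2 : P.map (Q 0) = P.map (Q k) := by
      rw [hQ, map_tandemMax_shift h_indep hA_ident hX_ident hY_ident k n,
        map_tandemMax_shift h_indep hA_ident hX_ident hY_ident 0 n]
    rw [e2, ← e, Measure.map_apply ((hRm k).prodMk (hQm k)) (measurableSet_sum_gt x),
      Measure.restrict_apply ((hRm k).prodMk (hQm k) (measurableSet_sum_gt x)), inter_comm]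
    rfl
  have hQ0 : (fun ω => tandemMax (fun i => A i ω) (fun i => X i ω) (fun i => Y i ω) n) = Q 0 := by
    simp [hQ]
  have : IsProbabilityMeasure (P.map (Q 0)) :=
    Measure.isProbabilityMeasure_map (hQm 0).aemeasurable
  rw [hQ0, overshootLaw, Measure.prod_sum_left, Measure.sum_apply _ (measurableSet_sum_gt x),
    Measure.map_apply (measurable_tandemMax (fun i _ => hA i) (fun i _ => hX i) (fun i _ => hY i))
      measurableSet_Ioi]
  calc _ ≤ _ := measure_mono hsub
    _ ≤ _ := measure_iUnion_le _
    _ = _ := tsum_congr hterm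

end Renewal

/-! ### Almost sure linear bounds on the walks -/

theorem exists_abs_sub_le_of_tendsto_div {u : ℕ → ℝ} {l : ℝ}
    (h : Tendsto (fun n : ℕ => u n / n) atTop (𝓝 l)) {δ : ℝ} (hδ : 0 < δ) :
    ∃ C, ∀ n : ℕ, |u n - n * l| ≤ C + δ * n := by
  obtain ⟨N, hN⟩ := eventually_atTop.1
    ((Metric.tendsto_nhds.1 h δ hδ).and (eventually_gt_atTop 0))
  refine ⟨∑ n ∈ Finset.range N, |u n - n * l|, fun n => ?_⟩
  rcases lt_or_ge n N with hn | hn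
  · have := Finset.single_le_sum (f := fun n : ℕ => |u n - n * l|) (fun _ _ => abs_nonneg _)
      (Finset.mem_range.2 hn)
    have h0 : 0 ≤ δ * n := by positivity
    linarith
  · obtain ⟨h1, h2⟩ := hN n hn
    have hn0 : (0 : ℝ) < n := by exact_mod_cast h2
    have e : u n - n * l = (u n / n - l) * n := by field_simp
    rw [Real.dist_eq] at h1
    have h3 : |u n - n * l| ≤ δ * n := by
      rw [e, abs_mul, abs_of_pos hn0]
      gcongr
    have : 0 ≤ ∑ n ∈ Finset.range N, |u n - n * l| := Finset.sum_nonneg fun _ _ => abs_nonneg _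
    linarith

/-- A deterministic consequence of linear growth: a path with a switch drifts no faster than the
larger of the two slopes, so the tandem walk has slope at most `max α β` up to small errors. -/
theorem exists_tandemWalk_le {A X Y : ℕ → ℝ} {α β c c₂ : ℝ}
    (hX : Tendsto (fun n : ℕ => walk A X n / n) atTop (𝓝 α))
    (hY : Tendsto (fun n : ℕ => walk A Y n / n) atTop (𝓝 β))
    (hα : α < -c) (hβ : β < -c) (hβ₂ : β < -c₂) :
    ∃ M, ∀ n : ℕ, walk A Y n + n * c₂ ≤ M ∧ tandemWalk A X Y n + n * c ≤ M := by
  -- Three errors `δ` accumulate in the tandem walk: two in its excess over the `X`-walk (`key`),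
  -- and one in the `X`-walk itself.
  obtain ⟨δ, hδ, h1, h2⟩ : ∃ δ > 0, max α β + 3 * δ ≤ -c ∧ β + δ ≤ -c₂ := by
    refine ⟨min ((-c - max α β) / 3) (-c₂ - β), ?_, ?_, ?_⟩
    · have := max_lt hα hβ
      exact lt_min (by linarith) (by linarith)
    · linarith [min_le_left ((-c - max α β) / 3) (-c₂ - β)]
    · linarith [min_le_right ((-c - max α β) / 3) (-c₂ - β)]
  obtain ⟨C₁, hC₁⟩ := exists_abs_sub_le_of_tendsto_div hX hδ
  obtain ⟨C₂, hC₂⟩ := exists_abs_sub_le_of_tendsto_div hY hδ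
  have hC₁0 : 0 ≤ C₁ := by simpa [walk_zero] using hC₁ 0
  have hC₂0 : 0 ≤ C₂ := by simpa [walk_zero] using hC₂ 0
  have key : ∀ n : ℕ, tandemWalk A X Y n - walk A X n ≤
      C₁ + C₂ + n * (max α β - α + 2 * δ) := by
    intro n
    induction n with
    | zero => simp only [tandemWalk, walk_zero]; simp; linarith
    | succ n ih =>
      have hg : 0 ≤ max α β - α + 2 * δ := by linarith [le_max_left α β]
      rw [tandemWalk, sub_le_iff_le_add, max_le_iff]
      constructor
      · rw [walk_succ]
        push_cast
        linarith
      · have a1 := (abs_le.1 (hC₁ (n + 1))).1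
        have a2 := (abs_le.1 (hC₂ (n + 1))).2
        have a3 : ((n + 1 : ℕ) : ℝ) * β ≤ ((n + 1 : ℕ) : ℝ) * max α β := by
          gcongr; exact le_max_right _ _
        linarith
  refine ⟨2 * C₁ + C₂, fun n => ⟨?_, ?_⟩⟩
  · have a2 := (abs_le.1 (hC₂ n)).2
    have a3 : (n : ℝ) * (β + δ) ≤ n * -c₂ := by gcongr
    linarith
  · have a1 := (abs_le.1 (hC₁ n)).2
    have a3 : (n : ℝ) * (max α β + 3 * δ) ≤ n * -c := by gcongr
    linarith [key n]

section

variable {Ω : Type*} [MeasurableSpace Ω] {P : Measure Ω}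

/-- The events decrease in `r` to an event on which the supremum is infinite, which is null. This
supplies the level `r` in the upper bound and the levels `T₁`, `T₂` in the lower bound. -/
theorem exists_measureReal_iUnion_lt [IsFiniteMeasure P] {f : ℕ → Ω → ℝ}
    (hf : ∀ n, Measurable (f n)) (hb : ∀ᵐ ω ∂P, ∃ M, ∀ n, f n ω ≤ M) {ε : ℝ} (hε : 0 < ε) :
    ∃ r, 0 ≤ r ∧ P.real (⋃ n, {ω | r < f n ω}) < ε := by
  have h := tendsto_measure_iInter_atTop (μ := P) (s := fun r : ℝ => ⋃ n, {ω | r < f n ω})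
    (fun r => (MeasurableSet.iUnion fun n =>
      measurableSet_lt measurable_const (hf n)).nullMeasurableSet)
    (fun r s h => iUnion_mono fun n ω (hω : s < f n ω) => lt_of_le_of_lt h hω)
    ⟨0, measure_ne_top _ _⟩
  have e : P (⋂ r : ℝ, ⋃ n, {ω | r < f n ω}) = 0 := by
    rw [← compl_mem_ae_iff]
    filter_upwards [hb] with ω ⟨M, hM⟩ hω
    obtain ⟨n, hn⟩ := mem_iUnion.1 (mem_iInter.1 hω M)
    exact absurd (hM n) (not_le.2 hn)
  rw [e] at h
  have h' : Tendsto (fun r : ℝ => P.real (⋃ n, {ω | r < f n ω})) atTop (𝓝 0) :=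
    (ENNReal.tendsto_toReal ENNReal.zero_ne_top).comp h
  obtain ⟨r, h1, h2⟩ := ((eventually_ge_atTop 0).and (h'.eventually (gt_mem_nhds hε))).exists
  exact ⟨r, h1, h2⟩

/-- The strong law of large numbers for `walk`. -/
theorem ae_tendsto_walk_div [IsProbabilityMeasure P] {A Y : ℕ → Ω → ℝ}
    (hA : ∀ k, Measurable (A k)) (hY : ∀ k, Measurable (Y k))
    (h_indep : iIndepFun (Sum.elim A Y) P) (hA_ident : ∀ n, IdentDistrib (A n) (A 0) P P)
    (hY_ident : ∀ n, IdentDistrib (Y n) (Y 0) P P) (hA_int : Integrable (A 0) P)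
    (hY_int : Integrable (Y 0) P) :
    ∀ᵐ ω ∂P, Tendsto (fun n : ℕ => walk (fun k => A k ω) (fun k => Y k ω) n / n) atTop
      (𝓝 ((∫ ω, Y 0 ω ∂P) - ∫ ω, A 0 ω ∂P)) := by
  have hm : ∀ i, Measurable (Sum.elim A Y i) := by
    rintro (i | i)
    exacts [hA i, hY i]
  rw [← integral_sub hY_int hA_int]
  refine strong_law_ae_real (fun k ω => Y k ω - A k ω) (hY_int.sub hA_int) ?_ ?_
  · intro i j hij
    have h := h_indep.indepFun_prodMk_prodMk hm (Sum.inr i) (Sum.inl i) (Sum.inr j) (Sum.inl j)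
      (by simpa using hij) (by simp) (by simp) (by simpa using hij)
    exact h.comp (φ := fun p : ℝ × ℝ => p.1 - p.2) (ψ := fun p : ℝ × ℝ => p.1 - p.2)
      (by fun_prop) (by fun_prop)
  · intro i
    have h : ∀ j, Y j ⟂ᵢ[P] A j := fun j => h_indep.indepFun (i := Sum.inr j) (j := Sum.inl j)
      (by simp)
    exact ((hY_ident i).prodMk (hA_ident i) (h i) (h 0)).comp
      (u := fun p : ℝ × ℝ => p.1 - p.2) (by fun_prop)

end

/-! ### Integrated tails and sums of tails -/

theorem IsSubexponential.exists_law {G : ℝ → ℝ} (h : IsSubexponential G) :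
    ∃ ν : Measure ℝ, IsSubexpLaw ν ∧ ∀ x, 0 ≤ x → 1 - G x = ν.real (Ioi x) := by
  obtain ⟨ν, h1, h2, h3, h4, h5⟩ := h
  refine ⟨ν, ⟨h1, h2, h4, h5⟩, fun x hx => ?_⟩
  rw [h3 x hx, ← compl_Iic, probReal_compl_eq_one_sub measurableSet_Iic]

section IntegratedTail

variable {ν φ : Measure ℝ} (hν : IsSubexpLaw ν)
  (hint : IntegrableOn (fun u => φ.real (Ioi u)) (Ioi 0))
  (hνφ : ∀ x, 0 ≤ x → ν.real (Ioi x) = min 1 (∫ u in Ioi x, φ.real (Ioi u)))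

include hν hνφ

theorem eventually_real_Ioi_eq_integral :
    ∀ᶠ x in atTop, ν.real (Ioi x) = ∫ u in Ioi x, φ.real (Ioi u) := by
  have := hν.prob
  filter_upwards [eventually_ge_atTop 0,
    (tendsto_real_Ioi_zero ν).eventually (gt_mem_nhds one_pos)] with x hx h1
  rw [hνφ x hx] at h1 ⊢
  rcases min_lt_iff.1 h1 with h | h
  · exact absurd h (lt_irrefl _)
  · exact min_eq_right h.le

include hint

/-- The tail of a law is negligible with respect to its integrated tail, if the latter is
long-tailed. -/
theorem tendsto_tail_div_integratedTail [IsFiniteMeasure φ] :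
    Tendsto (fun x => φ.real (Ioi x) / ν.real (Ioi x)) atTop (𝓝 0) := by
  -- The tail at `x` is at most its integral over `[x - 1, x]`, which is the increment `ν(x - 1, ∞)
  -- - ν(x, ∞)`, negligible for a long-tailed law.
  have h1 : Tendsto (fun x => ν.real (Ioi (x + -1)) / ν.real (Ioi x) - 1) atTop (𝓝 0) := by
    simpa using (hν.tendsto_shift (-1)).sub_const 1
  have hev := eventually_real_Ioi_eq_integral hν hνφ
  have hsh : Tendsto (fun x : ℝ => x + -1) atTop atTop :=
    tendsto_atTop_add_const_right _ (-1) tendsto_id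
  refine squeeze_zero' (Eventually.of_forall fun x => by positivity) ?_ h1
  filter_upwards [hev, hsh.eventually hev, eventually_ge_atTop 1] with x e1 e2 hx
  have hp := hν.real_pos x
  rw [div_sub_one hp.ne']
  refine div_le_div_of_nonneg_right ?_ hp.le
  rw [e1, e2]
  have i0 : IntegrableOn (fun u => φ.real (Ioi u)) (Ioi (x + -1)) :=
    hint.mono_set (Ioi_subset_Ioi (by linarith))
  rw [intervalIntegral.integral_Ioi_sub_Ioi i0 (by linarith)]
  have h2 : ∫ u in (x + -1)..x, φ.real (Ioi x) ≤ ∫ u in (x + -1)..x, φ.real (Ioi u) := by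
    refine intervalIntegral.integral_mono_on (by linarith) intervalIntegrable_const ?_
      fun u hu => antitone_real_Ioi φ hu.2
    exact (antitone_real_Ioi φ).intervalIntegrable
  simpa using h2

variable {g : ℝ → ℝ} {d : ℝ} (hg : Antitone g) (hg0 : ∀ x, 0 ≤ g x)
  (hgd : Tendsto (fun x => g x / φ.real (Ioi x)) atTop (𝓝 d)) (hφ : ∀ x, 0 < φ.real (Ioi x))

include hgd hφ

theorem tendsto_div_integratedTail [IsFiniteMeasure φ] :
    Tendsto (fun x => g x / ν.real (Ioi x)) atTop (𝓝 0) := by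
  have h := hgd.mul (tendsto_tail_div_integratedTail hν hint hνφ)
  rw [mul_zero] at h
  refine h.congr fun x => ?_
  have := hφ x
  field_simp

omit hν hνφ in
include hg hg0 in
theorem integrableOn_of_tail_equiv : IntegrableOn g (Ioi 0) := by
  obtain ⟨x₀, hx₀⟩ := eventually_atTop.1 (hgd.eventually (gt_mem_nhds (lt_add_one d)))
  have hm : ∀ s, AEStronglyMeasurable g (volume.restrict s) := fun s =>
    hg.measurable.aestronglyMeasurable
  have h1 : IntegrableOn g (Ioc 0 (max x₀ 0)) :=
    (hg.antitoneOn _).integrableOn_isCompact (isCompact_Icc (a := 0)) |>.mono_set Ioc_subset_Icc_self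
  have h2 : IntegrableOn g (Ioi (max x₀ 0)) := by
    refine Integrable.mono' ((hint.mono_set (Ioi_subset_Ioi (le_max_right _ _))).const_mul (d + 1))
      (hm _) ?_
    refine (ae_restrict_iff' measurableSet_Ioi).2 (Eventually.of_forall fun x hx => ?_)
    have := hx₀ x ((le_max_left _ _).trans (le_of_lt hx))
    rw [div_lt_iff₀ (hφ x)] at this
    rw [Real.norm_of_nonneg (hg0 x)]
    exact this.le
  rw [← Ioc_union_Ioi_eq_Ioi (le_max_right x₀ 0)]
  exact h1.union h2

include hg hg0 in
theorem tendsto_integral_div_integratedTail :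
    Tendsto (fun x => (∫ u in Ioi x, g u) / ν.real (Ioi x)) atTop (𝓝 d) := by
  have hgi := integrableOn_of_tail_equiv hint hg hg0 hgd hφ
  refine Metric.tendsto_nhds.2 fun ε hε => ?_
  obtain ⟨x₀, hx₀⟩ := eventually_atTop.1 (Metric.tendsto_nhds.1 hgd (ε / 2) (by positivity))
  filter_upwards [eventually_real_Ioi_eq_integral hν hνφ, eventually_ge_atTop x₀,
    eventually_ge_atTop 0] with x hx h1 h2
  have hp := hν.real_pos x
  have i1 : IntegrableOn (fun u => φ.real (Ioi u)) (Ioi x) := hint.mono_set (Ioi_subset_Ioi h2)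
  have i2 : IntegrableOn g (Ioi x) := hgi.mono_set (Ioi_subset_Ioi h2)
  have e : (∫ u in Ioi x, g u) / ν.real (Ioi x) - d =
      (∫ u in Ioi x, (g u - d * φ.real (Ioi u))) / ν.real (Ioi x) := by
    rw [integral_sub i2 (i1.const_mul d), integral_const_mul, ← hx]
    field_simp
  have hb : |∫ u in Ioi x, (g u - d * φ.real (Ioi u))| ≤ ∫ u in Ioi x, ε / 2 * φ.real (Ioi u) := by
    refine norm_integral_le_of_norm_le (f := fun u => g u - d * φ.real (Ioi u))
      (i1.const_mul _) ?_
    refine (ae_restrict_iff' measurableSet_Ioi).2 (Eventually.of_forall fun u hu => ?_)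
    have h3 := hx₀ u (h1.trans (le_of_lt hu))
    have h4 := hφ u
    have e2 : g u - d * φ.real (Ioi u) = (g u / φ.real (Ioi u) - d) * φ.real (Ioi u) := by
      field_simp
    rw [e2, norm_mul, Real.norm_of_nonneg h4.le]
    gcongr
    exact h3.le
  rw [integral_const_mul, ← hx] at hb
  rw [Real.dist_eq, e, abs_div, abs_of_pos hp, div_lt_iff₀ hp]
  nlinarith

end IntegratedTail

/-- Comparison of sum and integral for an antitone function with mesh `c`. The two sides differ by
at most `g y`, which is negligible against the integrated tail in the application. -/
theorem integral_div_le_tsum {g : ℝ → ℝ} (hg : Antitone g) (hg0 : ∀ x, 0 ≤ g x) {y c : ℝ}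
    (hc : 0 < c) (hgi : IntegrableOn g (Ioi y)) :
    (Summable fun k : ℕ => g (y + k * c)) ∧ (∫ u in Ioi y, g u) / c ≤ ∑' k : ℕ, g (y + k * c) ∧
      ∑' k : ℕ, g (y + k * c) ≤ g y + (∫ u in Ioi y, g u) / c := by
  set f : ℝ → ℝ := fun t => g (c * t + y) with hf
  have hfa : Antitone f := fun s t h => hg (by gcongr)
  have hI : ∀ N : ℕ, ∫ t in (0 : ℝ)..0 + N, f t = (∫ u in y..y + N * c, g u) / c := by
    intro N
    rw [hf, intervalIntegral.integral_comp_mul_add _ hc.ne', smul_eq_mul, inv_mul_eq_div]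
    congr 2 <;> ring
  have hef : ∀ k : ℕ, f (0 + k) = g (y + k * c) := fun k => by
    simp only [hf]; congr 1; ring
  have hlow : ∀ N : ℕ, (∫ u in y..y + N * c, g u) / c ≤ ∑ k ∈ Finset.range N, g (y + k * c) := by
    intro N
    rw [← hI]
    exact ((hfa.antitoneOn _).integral_le_sum).trans_eq (Finset.sum_congr rfl fun k _ => hef k)
  have htend : Tendsto (fun N : ℕ => (∫ u in y..y + N * c, g u) / c) atTop
      (𝓝 ((∫ u in Ioi y, g u) / c)) := by
    refine (intervalIntegral_tendsto_integral_Ioi y hgi ?_).div_const c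
    exact tendsto_atTop_add_const_left _ _ (tendsto_natCast_atTop_atTop.atTop_mul_const hc)
  have hup : ∀ N : ℕ, ∑ k ∈ Finset.range N, g (y + k * c) ≤ g y + (∫ u in Ioi y, g u) / c := by
    intro N
    calc ∑ k ∈ Finset.range N, g (y + k * c)
        ≤ ∑ k ∈ Finset.range (N + 1), g (y + k * c) :=
          Finset.sum_le_sum_of_subset_of_nonneg (Finset.range_mono (Nat.le_succ N))
            fun _ _ _ => hg0 _
      _ = ∑ k ∈ Finset.range N, f (0 + ((k + 1 : ℕ) : ℝ)) + g y := by
          rw [Finset.sum_range_succ']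
          simp only [hef]
          simp
      _ ≤ (∫ u in y..y + N * c, g u) / c + g y := by
          rw [← hI]; gcongr; exact (hfa.antitoneOn _).sum_le_integral
      _ ≤ (∫ u in Ioi y, g u) / c + g y := by
          gcongr
          rw [intervalIntegral.integral_of_le (by nlinarith [Nat.cast_nonneg (α := ℝ) N])]
          exact setIntegral_mono_set hgi (Eventually.of_forall fun _ => hg0 _)
            (Eventually.of_forall fun _ h => Ioc_subset_Ioi_self h)
      _ = _ := add_comm _ _
  have hs : Summable fun k : ℕ => g (y + k * c) :=
    summable_of_sum_range_le (fun _ => hg0 _) hup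
  refine ⟨hs, ?_, hs.tsum_le_of_sum_range_le hup⟩
  exact le_of_tendsto_of_tendsto' htend hs.hasSum.tendsto_sum_nat hlow

/-- The shift `s` is absorbed by long-tailedness. It is needed because the barrier levels `r`, `T₁`,
`T₂` displace `x` by constants. -/
theorem IsSubexpLaw.tendsto_tsum_div {ν : Measure ℝ} (hν : IsSubexpLaw ν) {g : ℝ → ℝ} {d : ℝ}
    (hg : Antitone g) (hg0 : ∀ x, 0 ≤ g x) (hgi : IntegrableOn g (Ioi 0))
    (h0 : Tendsto (fun x => g x / ν.real (Ioi x)) atTop (𝓝 0))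
    (hd : Tendsto (fun x => (∫ u in Ioi x, g u) / ν.real (Ioi x)) atTop (𝓝 d)) {c : ℝ} (hc : 0 < c)
    (s : ℝ) :
    Tendsto (fun x => (∑' k : ℕ, g (x + s + k * c)) / ν.real (Ioi x)) atTop (𝓝 (d / c)) := by
  have hsh : Tendsto (fun x : ℝ => x + s) atTop atTop := tendsto_atTop_add_const_right _ s tendsto_id
  have hbase : Tendsto (fun x => (∑' k : ℕ, g (x + k * c)) / ν.real (Ioi x)) atTop (𝓝 (d / c)) := by
    have hup : Tendsto (fun x => g x / ν.real (Ioi x) +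
        (∫ u in Ioi x, g u) / ν.real (Ioi x) / c) atTop (𝓝 (d / c)) := by
      simpa using h0.add (hd.div_const c)
    refine tendsto_of_tendsto_of_tendsto_of_le_of_le' (hd.div_const c) hup ?_ ?_
    · filter_upwards [eventually_ge_atTop 0] with x hx
      obtain ⟨-, h, -⟩ := integral_div_le_tsum hg hg0 hc (hgi.mono_set (Ioi_subset_Ioi hx))
      rw [div_right_comm]
      exact div_le_div_of_nonneg_right h (hν.real_pos x).le
    · filter_upwards [eventually_ge_atTop 0] with x hx
      obtain ⟨-, -, h⟩ := integral_div_le_tsum hg hg0 hc (hgi.mono_set (Ioi_subset_Ioi hx))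
      rw [div_right_comm, ← add_div]
      exact div_le_div_of_nonneg_right h (hν.real_pos x).le
  have h := (hbase.comp hsh).mul (hν.tendsto_shift s)
  rw [mul_one] at h
  refine h.congr fun x => ?_
  have := hν.real_pos (x + s)
  rw [Function.comp_apply, div_mul_div_cancel₀ this.ne']

/-! ### The delay as a maximum over paths -/

theorem exists_departure₁_eq (T s₁ : ℤ → ℝ) (m : ℤ) (k : ℕ) :
    ∃ j ≤ k, departure₁ T s₁ m k = T (m + j) + ∑ l ∈ Finset.Ico j (k + 1), s₁ (m + l) := by
  induction k with
  | zero => exact ⟨0, le_rfl, by simp [departure₁]⟩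
  | succ k ih =>
    rw [departure₁]
    rcases max_choice (T (m + (k + 1))) (departure₁ T s₁ m k) with h | h
    · exact ⟨k + 1, le_rfl, by rw [h]; simp⟩
    · obtain ⟨j, hj, e⟩ := ih
      refine ⟨j, by omega, ?_⟩
      rw [h, e, Finset.sum_Ico_succ_top (by omega : j ≤ k + 1)]
      push_cast; ring

theorem le_departure₁ (T s₁ : ℤ → ℝ) (m : ℤ) {j k : ℕ} (hj : j ≤ k) :
    T (m + j) + ∑ l ∈ Finset.Ico j (k + 1), s₁ (m + l) ≤ departure₁ T s₁ m k := by
  induction k with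
  | zero => obtain rfl : j = 0 := by omega
            simp [departure₁]
  | succ k ih =>
    rw [departure₁]
    rcases Nat.lt_or_ge k j with h | h
    · obtain rfl : j = k + 1 := by omega
      simp
    · rw [Finset.sum_Ico_succ_top (by omega : j ≤ k + 1)]
      have := (ih h).trans (le_max_right (T (m + (k + 1))) _)
      push_cast
      linarith

theorem exists_departure₂_eq (T s₁ s₂ : ℤ → ℝ) (m : ℤ) (k : ℕ) :
    ∃ j i, j ≤ i ∧ i ≤ k ∧ departure₂ T s₁ s₂ m k = T (m + j) +
      ∑ l ∈ Finset.Ico j (i + 1), s₁ (m + l) + ∑ l ∈ Finset.Ico i (k + 1), s₂ (m + l) := by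
  induction k with
  | zero => exact ⟨0, 0, le_rfl, le_rfl, by simp [departure₁, departure₂]⟩
  | succ k ih =>
    rw [departure₂]
    rcases max_choice (departure₁ T s₁ m (k + 1)) (departure₂ T s₁ s₂ m k) with h | h
    · obtain ⟨j, hj, e⟩ := exists_departure₁_eq T s₁ m (k + 1)
      exact ⟨j, k + 1, hj, le_rfl, by rw [h, e]; simp⟩
    · obtain ⟨j, i, hj, hi, e⟩ := ih
      refine ⟨j, i, hj, by omega, ?_⟩
      rw [h, e, Finset.sum_Ico_succ_top (by omega : i ≤ k + 1)]
      push_cast; ring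

theorem le_departure₂ (T s₁ s₂ : ℤ → ℝ) (m : ℤ) {j i k : ℕ} (hj : j ≤ i) (hi : i ≤ k) :
    T (m + j) + ∑ l ∈ Finset.Ico j (i + 1), s₁ (m + l) + ∑ l ∈ Finset.Ico i (k + 1), s₂ (m + l)
      ≤ departure₂ T s₁ s₂ m k := by
  induction k with
  | zero => obtain rfl : i = 0 := by omega
            obtain rfl : j = 0 := by omega
            simp [departure₁, departure₂]
  | succ k ih =>
    rw [departure₂]
    rcases Nat.lt_or_ge k i with h | h
    · obtain rfl : i = k + 1 := by omega
      have := (le_departure₁ T s₁ m hj).trans (le_max_left _ (departure₂ T s₁ s₂ m k))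
      simpa using this
    · rw [Finset.sum_Ico_succ_top (by omega : i ≤ k + 1)]
      have := (ih h).trans (le_max_right (departure₁ T s₁ m (k + 1)) _)
      push_cast
      linarith

/-- The weight of the path that visits station 1 with the customers `-j, …, -i` and station 2 with
the customers `-i, …, 0`. -/
noncomputable def pathWeight (τ s₁ s₂ : ℤ → ℝ) (i j : ℕ) : ℝ :=
  ∑ k ∈ Finset.range (i + 1), s₂ (-k) + ∑ k ∈ Finset.Ico i (j + 1), s₁ (-k)
    - ∑ k ∈ Finset.range j, τ (-1 - k)

section Paths

variable {T τ : ℤ → ℝ} (hτ : ∀ n, τ n = T (n + 1) - T n) (s₁ s₂ : ℤ → ℝ)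

include hτ

theorem arrival_sub (j : ℕ) : T (-j) - T 0 = -∑ k ∈ Finset.range j, τ (-1 - k) := by
  induction j with
  | zero => simp
  | succ j ih =>
    rw [Finset.sum_range_succ, neg_add, ← ih, hτ]
    have e1 : (-1 - j + 1 : ℤ) = -j := by ring
    have e2 : (-((j + 1 : ℕ) : ℤ)) = -1 - j := by push_cast; ring
    rw [e1, e2]; ring

theorem pathWeight_eq {n i j : ℕ} (hj : j ≤ i) (hi : i ≤ n) :
    T (-n + j) + ∑ l ∈ Finset.Ico j (i + 1), s₁ (-n + l)
      + ∑ l ∈ Finset.Ico i (n + 1), s₂ (-n + l) - T 0 = pathWeight τ s₁ s₂ (n - i) (n - j) := by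
  have h : ∀ (f : ℤ → ℝ) (p q : ℕ), q ≤ n →
      ∑ l ∈ Finset.Ico p (q + 1), f (-n + l) = ∑ k ∈ Finset.Ico (n - q) (n + 1 - p), f (-k) := by
    intro f p q hq
    have := Finset.sum_Ico_reflect (fun k : ℕ => f (-k)) p (m := q + 1) (n := n) (by omega)
    rw [show n + 1 - (q + 1) = n - q by omega] at this
    rw [← this]
    refine Finset.sum_congr rfl fun l hl => ?_
    have := (Finset.mem_Ico.1 hl).2
    congr 1
    push_cast [Nat.cast_sub (show l ≤ n by omega)]
    ring
  have ha := arrival_sub hτ (n - j)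
  rw [Nat.cast_sub (hj.trans hi), neg_sub, show (j : ℤ) - n = -n + j by ring] at ha
  rw [h s₁ j i hi, h s₂ i n le_rfl, pathWeight, Nat.sub_self, Finset.range_eq_Ico,
    show n + 1 - i = n - i + 1 by omega, show n + 1 - j = n - j + 1 by omega]
  linarith

theorem exists_delayFrom_eq (n : ℕ) :
    ∃ i j, i ≤ j ∧ j ≤ n ∧ delayFrom T s₁ s₂ n = pathWeight τ s₁ s₂ i j := by
  obtain ⟨j, i, hj, hi, e⟩ := exists_departure₂_eq T s₁ s₂ (-n) n
  exact ⟨n - i, n - j, by omega, by omega, by rw [delayFrom, e, pathWeight_eq hτ s₁ s₂ hj hi]⟩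

theorem pathWeight_le_delayFrom {n i j : ℕ} (hi : i ≤ j) (hj : j ≤ n) :
    pathWeight τ s₁ s₂ i j ≤ delayFrom T s₁ s₂ n := by
  have h := le_departure₂ T s₁ s₂ (-n) (show n - j ≤ n - i by omega) (show n - i ≤ n by omega)
  have e := pathWeight_eq hτ s₁ s₂ (show n - j ≤ n - i by omega) (show n - i ≤ n by omega)
  rw [show n - (n - i) = i by omega, show n - (n - j) = j by omega] at e
  rw [← e, delayFrom]
  linarith

/-- The path that spends its whole length at station 1 (`i = 0`). It is used when station 1 is the
bottleneck. -/
theorem walk_add_service₁_le_delayFrom (n : ℕ) (h0 : 0 ≤ s₂ 0) :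
    walk (fun k => τ (-1 - k)) (fun k => s₁ (-k)) n + s₁ (-n) ≤ delayFrom T s₁ s₂ n := by
  refine le_trans ?_ (pathWeight_le_delayFrom hτ s₁ s₂ (Nat.zero_le n) le_rfl)
  rw [pathWeight, walk, Finset.sum_sub_distrib, ← Finset.range_eq_Ico,
    Finset.sum_range_succ (fun k : ℕ => s₁ (-k))]
  simp
  linarith

/-- The path that crosses to station 2 at once (`i = j = n`). It displays both services of customer
`-n`, so it serves jumps at station 2, and also jumps at station 1 when station 2 is the bottleneck.
-/
theorem walk_add_service₂_le_delayFrom (n : ℕ) :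
    walk (fun k => τ (-1 - k)) (fun k => s₂ (-k)) n + s₂ (-n) + s₁ (-n) ≤
      delayFrom T s₁ s₂ n := by
  refine le_trans ?_ (pathWeight_le_delayFrom hτ s₁ s₂ (le_refl n) le_rfl)
  rw [pathWeight, walk, Finset.sum_sub_distrib, Finset.sum_range_succ]
  simp
  linarith

end Paths

theorem walk_add_walk_le_tandemWalk (A X Y : ℕ → ℝ) {p q : ℕ} (h : p ≤ q) :
    walk A Y p + (walk A X q - walk A X p) ≤ tandemWalk A X Y q := by
  induction q with
  | zero => obtain rfl : p = 0 := by omega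
            simp [walk_zero, tandemWalk]
  | succ q ih =>
    rcases Nat.lt_or_ge q p with h' | h'
    · obtain rfl : p = q + 1 := by omega
      simpa using walk_le_tandemWalk A X Y (q + 1)
    · refine le_trans ?_ (le_max_left _ _)
      rw [walk_succ]
      linarith [ih h']

/-- On a path, the switching customer `-i` is served at both stations. Delaying the `Y`-sequence by
one customer makes every step collect exactly one of `X k`, `Y k`. The services `s₂ 0`, `s₂ (-1)`,
`s₁ 0` are set apart, and the sign conditions allow adding those that a given path does not use. -/
theorem delayFrom_le {T τ : ℤ → ℝ} (hτ : ∀ n, τ n = T (n + 1) - T n) {s₁ s₂ : ℤ → ℝ}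
    (h₁ : 0 ≤ s₁ 0) (h₂ : 0 ≤ s₂ (-1)) (n : ℕ) :
    delayFrom T s₁ s₂ n ≤ (s₂ 0 + (s₂ (-1) + s₁ 0)) + tandemMax (fun k => τ (-1 - k))
      (fun k => s₁ (-1 - k)) (fun k => s₂ (-2 - k)) n := by
  obtain ⟨i, j, hi, hj, e⟩ := exists_delayFrom_eq hτ s₁ s₂ n
  rw [e]
  set A : ℕ → ℝ := fun k => τ (-1 - k)
  set X : ℕ → ℝ := fun k => s₁ (-1 - k)
  set Y : ℕ → ℝ := fun k => s₂ (-2 - k)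
  have hmax := tandemWalk_le_tandemMax A X Y hj
  have hX : ∀ p q : ℕ, ∑ k ∈ Finset.Ico (p + 1) (q + 1), s₁ (-k) = ∑ k ∈ Finset.Ico p q, X k := by
    intro p q
    rw [← Finset.sum_Ico_add' (fun k : ℕ => s₁ (-k))]
    refine Finset.sum_congr rfl fun k _ => ?_
    simp only [X]
    congr 1; push_cast; ring
  have hXA : ∀ p q : ℕ, p ≤ q → walk A X q - walk A X p + ∑ k ∈ Finset.range q, A k
      - ∑ k ∈ Finset.range p, A k = ∑ k ∈ Finset.Ico p q, X k := by
    intro p q hpq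
    rw [Finset.sum_Ico_eq_sub _ hpq, walk, walk, Finset.sum_sub_distrib, Finset.sum_sub_distrib]
    ring
  rw [pathWeight]
  cases i with
  | zero =>
    have hw := walk_add_walk_le_tandemWalk A X Y (Nat.zero_le j)
    have h1 := hXA 0 j (Nat.zero_le j)
    rw [Finset.sum_eq_sum_Ico_succ_bot (Nat.succ_pos j), zero_add, ← zero_add 1, hX, ← h1]
    simp only [walk_zero, zero_add] at hw ⊢
    simp
    linarith
  | succ p =>
    have hw := walk_add_walk_le_tandemWalk A X Y (show p ≤ j by omega)
    have h1 := hXA p j (by omega)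
    have h2 : ∑ k ∈ Finset.range (p + 1 + 1), s₂ (-k) =
        s₂ 0 + s₂ (-1) + (walk A Y p + ∑ k ∈ Finset.range p, A k) := by
      rw [Finset.sum_range_succ', Finset.sum_range_succ', walk, Finset.sum_sub_distrib]
      have : ∑ k ∈ Finset.range p, s₂ (-((k + 1 + 1 : ℕ) : ℤ)) = ∑ k ∈ Finset.range p, Y k := by
        refine Finset.sum_congr rfl fun k _ => ?_
        simp only [Y]
        congr 1; push_cast; ring
      rw [this]
      simp
      ring
    rw [hX, ← h1, h2]
    linarith

/-! ### Upper bound for the running maximum -/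

/-- Adding an independent variable with negligible tail to a family of variables with uniformly
dominated tails. -/
theorem IsSubexpLaw.eventually_prod_le_of_negligible {ν : Measure ℝ} (hν : IsSubexpLaw ν)
    {μ : Measure ℝ} [IsProbabilityMeasure μ] {ρ : ℕ → Measure ℝ} [∀ n, IsProbabilityMeasure (ρ n)]
    {K K' : ℝ} (hK : 0 ≤ K)
    (hμ : ∀ m > 0, ∀ᶠ x in atTop, μ.real (Ioi x) ≤ m * ν.real (Ioi x))
    (hρ : ∀ᶠ x in atTop, ∀ n, (ρ n).real (Ioi x) ≤ K * ν.real (Ioi x)) (hK' : K < K') :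
    ∀ᶠ x in atTop, ∀ n, (μ.prod (ρ n)).real {p : ℝ × ℝ | x < p.1 + p.2} ≤
      K' * ν.real (Ioi x) :=
  -- Here the kernel has mass `1` and tail constant `0`, so `K` is reproduced.
  hν.improve_bound le_rfl hK hμ hρ (by simpa using hK')

section

variable {Ω : Type*} [MeasurableSpace Ω] {P : Measure Ω}

theorem ProbabilityTheory.IndepFun.measureReal_add_gt [IsFiniteMeasure P] {f g : Ω → ℝ} (h : f ⟂ᵢ[P] g)
    (hf : Measurable f) (hg : Measurable g) (x : ℝ) :
    P.real {ω | x < f ω + g ω} = ((P.map f).prod (P.map g)).real {p : ℝ × ℝ | x < p.1 + p.2} := by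
  rw [← h.map_prod_eq_prod_map_map hf.aemeasurable hg.aemeasurable,
    map_measureReal_apply (hf.prodMk hg) (measurableSet_sum_gt x)]
  rfl

theorem map_real_Ioi {f : Ω → ℝ} (hf : Measurable f) (x : ℝ) :
    (P.map f).real (Ioi x) = P.real {ω | x < f ω} :=
  map_measureReal_apply hf measurableSet_Ioi

/-- The tail sums `∑ k, P(V > x + s + k c)` are asymptotically `d / c` times the tail of `ν`. -/
structure HasTailSums (P : Measure Ω) (ν : Measure ℝ) (V : Ω → ℝ) (d : ℝ) : Prop where
  summable : ∀ c > 0, ∀ y ≥ 0, Summable fun k : ℕ => P.real {ω | y + k * c < V ω}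
  tendsto : ∀ c > 0, ∀ s, Tendsto
    (fun x => (∑' k : ℕ, P.real {ω | x + s + k * c < V ω}) / ν.real (Ioi x)) atTop (𝓝 (d / c))

variable [IsProbabilityMeasure P]

theorem IsSubexpLaw.negligible_add {ν : Measure ℝ} (hν : IsSubexpLaw ν) {f g : Ω → ℝ}
    (h : f ⟂ᵢ[P] g) (hf : Measurable f) (hg : Measurable g)
    (hfν : ∀ m > 0, ∀ᶠ x in atTop, P.real {ω | x < f ω} ≤ m * ν.real (Ioi x))
    (hgν : ∀ m > 0, ∀ᶠ x in atTop, P.real {ω | x < g ω} ≤ m * ν.real (Ioi x)) :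
    ∀ m > 0, ∀ᶠ x in atTop, P.real {ω | x < f ω + g ω} ≤ m * ν.real (Ioi x) := by
  intro m hm
  have := Measure.isProbabilityMeasure_map (μ := P) hf.aemeasurable
  have := Measure.isProbabilityMeasure_map (μ := P) hg.aemeasurable
  simp_rw [← map_real_Ioi hf] at hfν
  simp_rw [← map_real_Ioi hg] at hgν
  have h1 := hν.eventually_prod_le_of_negligible (ρ := fun _ => P.map g)
    (show 0 ≤ m / 2 by positivity) hfν
    ((hgν (m / 2) (by positivity)).mono fun x hx _ => hx) (half_lt_self hm)
  filter_upwards [h1] with x hx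
  rw [h.measureReal_add_gt hf hg]
  exact hx 0

variable {A X Y : ℕ → Ω → ℝ}

theorem overshootLaw_real_le (hA : ∀ k, Measurable (A k)) (hX : ∀ k, Measurable (X k))
    (hY : ∀ k, Measurable (Y k)) (hA0 : ∀ k, ∀ᵐ ω ∂P, 0 ≤ A k ω)
    (hX_ident : ∀ n, IdentDistrib (X n) (X 0) P P)
    (hY_ident : ∀ n, IdentDistrib (Y n) (Y 0) P P) {r c c₂ x : ℝ} (hr : 0 ≤ r)
    (hsX : Summable fun k : ℕ => P.real {ω | x - r + k * c < X 0 ω})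
    (hsY : Summable fun k : ℕ => P.real {ω | x - r + k * c₂ < Y 0 ω}) :
    (overshootLaw P A X Y r c c₂).real (Ioi x) ≤ ∑' k : ℕ, P.real {ω | x - r + k * c < X 0 ω} +
      ∑' k : ℕ, P.real {ω | x - r + k * c₂ < Y 0 ω} := by
  have key : ∀ {V : ℕ → Ω → ℝ} {c : ℝ}, (∀ n, IdentDistrib (V n) (V 0) P P) →
      (Summable fun k : ℕ => P.real {ω | x - r + k * c < V 0 ω}) →
      ∑' k : ℕ, P {ω | x - r + k * c < V k ω} =
        ENNReal.ofReal (∑' k : ℕ, P.real {ω | x - r + k * c < V 0 ω}) := by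
    intro V c hV hs
    rw [ENNReal.ofReal_tsum_of_nonneg (fun _ => measureReal_nonneg) hs]
    refine tsum_congr fun k => ?_
    rw [ofReal_measureReal]
    exact (hV k).measure_mem_eq (s := Ioi (x - r + k * c)) measurableSet_Ioi
  have h := overshootLaw_Ioi_le hA hX hY hA0 hr c c₂ x
  rw [key hX_ident hsX, key hY_ident hsY, ← ENNReal.ofReal_add (tsum_nonneg fun _ =>
    measureReal_nonneg) (tsum_nonneg fun _ => measureReal_nonneg)] at h
  exact ENNReal.toReal_le_of_le_ofReal (add_nonneg (tsum_nonneg fun _ => measureReal_nonneg)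
    (tsum_nonneg fun _ => measureReal_nonneg)) h

/-- Uniform upper bound for the tails of `tandemMax`. -/
theorem eventually_tandemMax_le {ν : Measure ℝ} (hν : IsSubexpLaw ν)
    (hA : ∀ k, Measurable (A k)) (hX : ∀ k, Measurable (X k))
    (hY : ∀ k, Measurable (Y k)) (hA0 : ∀ k, ∀ᵐ ω ∂P, 0 ≤ A k ω)
    (h_indep : iIndepFun (Sum.elim A (Sum.elim X Y)) P)
    (hA_ident : ∀ n, IdentDistrib (A n) (A 0) P P) (hX_ident : ∀ n, IdentDistrib (X n) (X 0) P P)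
    (hY_ident : ∀ n, IdentDistrib (Y n) (Y 0) P P) (hA_int : Integrable (A 0) P)
    (hX_int : Integrable (X 0) P) (hY_int : Integrable (Y 0) P) {d₁ d₂ c c₂ : ℝ}
    (hd₁ : 0 ≤ d₁) (hd₂ : 0 ≤ d₂) (hXt : HasTailSums P ν (X 0) d₁) (hYt : HasTailSums P ν (Y 0) d₂)
    (hc : 0 < c) (hc₂ : 0 < c₂)
    (hcX : c < (∫ ω, A 0 ω ∂P) - ∫ ω, X 0 ω ∂P) (hcY : c < (∫ ω, A 0 ω ∂P) - ∫ ω, Y 0 ω ∂P)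
    (hc₂Y : c₂ < (∫ ω, A 0 ω ∂P) - ∫ ω, Y 0 ω ∂P) {h : ℝ} (hh : d₁ / c + d₂ / c₂ < h) :
    ∀ᶠ x in atTop, ∀ n, P.real {ω | x < tandemMax (fun k => A k ω) (fun k => X k ω)
      (fun k => Y k ω) n} ≤ h * ν.real (Ioi x) := by
  have := hν.prob
  set m := d₁ / c + d₂ / c₂ with hm
  have hm0 : 0 ≤ m := by positivity
  have hh0 : 0 < h := hm0.trans_lt hh
  have hwX : ∀ᵐ ω ∂P, Tendsto (fun n : ℕ => walk (fun k => A k ω) (fun k => X k ω) n / n) atTop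
      (𝓝 ((∫ ω, X 0 ω ∂P) - ∫ ω, A 0 ω ∂P)) := by
    refine ae_tendsto_walk_div hA hX ?_ hA_ident hX_ident hA_int hX_int
    have hinj : Function.Injective (Sum.map id Sum.inl : ℕ ⊕ ℕ → ℕ ⊕ ℕ ⊕ ℕ) :=
      Function.injective_id.sumMap Sum.inl_injective
    convert! h_indep.precomp hinj using 2 with i
    rcases i with i | i <;> rfl
  have hwY : ∀ᵐ ω ∂P, Tendsto (fun n : ℕ => walk (fun k => A k ω) (fun k => Y k ω) n / n) atTop
      (𝓝 ((∫ ω, Y 0 ω ∂P) - ∫ ω, A 0 ω ∂P)) := by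
    refine ae_tendsto_walk_div hA hY ?_ hA_ident hY_ident hA_int hY_int
    have hinj : Function.Injective (Sum.map id Sum.inr : ℕ ⊕ ℕ → ℕ ⊕ ℕ ⊕ ℕ) :=
      Function.injective_id.sumMap Sum.inr_injective
    convert! h_indep.precomp hinj using 2 with i
    rcases i with i | i <;> rfl
  have hmw : ∀ n, Measurable fun ω => walk (fun k => A k ω) (fun k => Y k ω) n := fun n =>
    measurable_walk (fun k _ => hA k) (fun k _ => hY k)
  have hmR : ∀ n, Measurable fun ω =>
      tandemWalk (fun k => A k ω) (fun k => X k ω) (fun k => Y k ω) n := fun n =>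
    measurable_tandemWalk (fun k _ => hA k) (fun k _ => hX k) (fun k _ => hY k)
  -- The level `r` is raised until the crossing probability `γ` is below `1 - m / h`, which is
  -- exactly the condition `m / (1 - γ) < h`.
  obtain ⟨r, hr, hrlt⟩ := exists_measureReal_iUnion_lt (P := P)
    (f := fun n ω => max (walk (fun k => A k ω) (fun k => Y k ω) n + n * c₂)
      (tandemWalk (fun k => A k ω) (fun k => X k ω) (fun k => Y k ω) n + n * c))
    (fun n => ((hmw n).add_const _).max ((hmR n).add_const _)) (by
      filter_upwards [hwX, hwY] with ω h1 h2
      obtain ⟨M, hM⟩ := exists_tandemWalk_le (c := c) (c₂ := c₂) h1 h2 (by linarith) (by linarith)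
        (by linarith)
      exact ⟨M, fun n => max_le (hM n).1 (hM n).2⟩)
    (show 0 < 1 - m / h by rw [sub_pos, div_lt_one hh0]; exact hh)
  have hγ : (overshootLaw P A X Y r c c₂).real univ < 1 - m / h := by
    rw [Measure.real, overshootLaw_univ hA hX hY]
    convert! hrlt using 2
    rw [Measure.real]
    congr 2
    ext ω
    simp only [exceeds, mem_iUnion, mem_union, mem_ofPred_eq, lt_max_iff, sub_lt_iff_lt_add]
  have hfin := isFiniteMeasure_overshootLaw (P := P) hA hX hY r c c₂
  have hmQ : ∀ n, Measurable fun ω =>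
      tandemMax (fun k => A k ω) (fun k => X k ω) (fun k => Y k ω) n := fun n =>
    measurable_tandemMax (fun k _ => hA k) (fun k _ => hX k) (fun k _ => hY k)
  have hprob : ∀ n, IsProbabilityMeasure (P.map fun ω =>
      tandemMax (fun k => A k ω) (fun k => X k ω) (fun k => Y k ω) n) := fun n =>
    Measure.isProbabilityMeasure_map (hmQ n).aemeasurable
  have hmh : 0 ≤ m / h := by positivity
  have hfinal := hν.eventually_le_of_renewal (μ := overshootLaw P A X Y r c c₂)
    (ρ := fun n => P.map fun ω =>
      tandemMax (fun k => A k ω) (fun k => X k ω) (fun k => Y k ω) n) (r := r) (m := m) (h := h)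
    hm0 (by linarith) ?_ ?_ ?_ ?_
  · filter_upwards [hfinal] with x hx n
    rw [← map_real_Ioi (hmQ n)]
    exact hx n
  · intro m' hm'
    have ht := (hXt.tendsto c hc (-r)).add (hYt.tendsto c₂ hc₂ (-r))
    filter_upwards [ht.eventually (gt_mem_nhds hm'), eventually_ge_atTop r] with x hx hxr
    rw [← add_div, div_lt_iff₀ (hν.real_pos x)] at hx
    simp only [← sub_eq_add_neg] at hx
    exact (overshootLaw_real_le hA hX hY hA0 hX_ident hY_ident hr
      (hXt.summable c hc _ (by linarith)) (hYt.summable c₂ hc₂ _ (by linarith))).trans hx.le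
  · intro x hx
    rw [map_real_Ioi (hmQ 0)]
    simp [tandemMax, not_lt.2 hx]
  · intro n x hx
    exact ENNReal.toReal_mono (measure_ne_top _ _)
      (renewal_inequality hA hX hY h_indep hA_ident hX_ident hY_ident hr hc.le c₂ hx n)
  · rw [div_lt_iff₀ (by linarith)]
    have h1 : h * (overshootLaw P A X Y r c c₂).real univ < h * (1 - m / h) := by gcongr
    have h2 : h * (m / h) = m := mul_div_cancel₀ m hh0.ne'
    linarith

end

/-! ### Lower bound from a single big jump -/

section

variable {Ω : Type*} [MeasurableSpace Ω] {P : Measure Ω} [IsProbabilityMeasure P]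

/-- A lower bound for the probability of a union of rare, pairwise independent events `B i`, each
restricted to an independent and likely event `G i`. -/
theorem sum_mul_le_measureReal_of_rare {ι : Type*} {B G : ι → Set Ω} {U : Set Ω}
    (hB : ∀ i, MeasurableSet (B i)) (hG : ∀ i, MeasurableSet (G i)) {ε s : ℝ}
    (hGε : ∀ i, 1 - ε ≤ P.real (G i))
    (hBG : ∀ i, P.real (B i ∩ G i) = P.real (B i) * P.real (G i))
    (hBB : ∀ i j, i ≠ j → P.real (B i ∩ B j) = P.real (B i) * P.real (B j))
    (hU : ∀ i, ∀ᵐ ω ∂P, ω ∈ B i → ω ∈ G i → ω ∈ U) (F : Finset ι)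
    (hs : ∑ i ∈ F, P.real (B i) ≤ s) :
    ∑ i ∈ F, P.real (B i) * (1 - ε - s) ≤ P.real U := by
  classical
  -- Removing the overlaps with the other rare events makes the pieces disjoint. By pairwise
  -- independence this costs at most a fraction `s` of `P(B i)`.
  set D : ι → Set Ω := fun i => (B i ∩ G i) \ ⋃ j ∈ F.erase i, B i ∩ B j with hD
  have hDm : ∀ i, MeasurableSet (D i) := fun i => ((hB i).inter (hG i)).diff
    (Finset.measurableSet_biUnion _ fun j _ => (hB i).inter (hB j))
  have hDle : ∀ i, P.real (B i) * (1 - ε - s) ≤ P.real (D i) := by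
    intro i
    have h1 : P.real (⋃ j ∈ F.erase i, B i ∩ B j) ≤ P.real (B i) * s := by
      refine (measureReal_biUnion_finset_le _ _).trans ?_
      rw [Finset.sum_congr rfl fun j hj => hBB i j (Finset.ne_of_mem_erase hj).symm,
        ← Finset.mul_sum]
      refine mul_le_mul_of_nonneg_left (le_trans ?_ hs) measureReal_nonneg
      exact Finset.sum_le_sum_of_subset_of_nonneg (Finset.erase_subset _ _)
        fun _ _ _ => measureReal_nonneg
    have h2 := le_measureReal_sdiff (μ := P) (s₁ := B i ∩ G i)
      (s₂ := ⋃ j ∈ F.erase i, B i ∩ B j) (h := measure_ne_top _ _)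
    rw [hBG] at h2
    have h3 := mul_le_mul_of_nonneg_left (hGε i) (measureReal_nonneg (μ := P) (s := B i))
    linarith
  have hdisj : (F : Set ι).PairwiseDisjoint D := by
    intro i hi j hj hij
    refine Set.disjoint_left.2 fun ω h1 h2 => h1.2 ?_
    exact mem_iUnion₂.2 ⟨j, Finset.mem_erase.2 ⟨hij.symm, hj⟩, h1.1.1, h2.1.1⟩
  calc ∑ i ∈ F, P.real (B i) * (1 - ε - s) ≤ ∑ i ∈ F, P.real (D i) :=
        Finset.sum_le_sum fun i _ => hDle i
    _ = P.real (⋃ i ∈ F, D i) := (measureReal_biUnion_finset hdisj fun i _ => hDm i).symm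
    _ ≤ P.real U := by
      refine ENNReal.toReal_mono (measure_ne_top _ _) (measure_mono_ae ?_)
      filter_upwards [(Finset.eventually_all F).2 fun i _ => hU i] with ω hω h
      obtain ⟨i, hi, h⟩ := mem_iUnion₂.1 h
      exact hω i hi h.1.1 h.1.2

/-- Lower bound from a single large value of one of the variables `V₁ n`, `V₂ n`. -/
theorem eventually_le_of_single_big_jump {ν : Measure ℝ} (hν : IsSubexpLaw ν)
    {V₁ V₂ W₁ W₂ : ℕ → Ω → ℝ} {U : ℝ → Set Ω} {d₁ d₂ c c₂ : ℝ}
    (hV₁ : ∀ n, Measurable (V₁ n)) (hV₂ : ∀ n, Measurable (V₂ n))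
    (hW₁ : ∀ n, Measurable (W₁ n)) (hW₂ : ∀ n, Measurable (W₂ n))
    (hV : iIndepFun (Sum.elim V₁ V₂) P)
    (hV₁_ident : ∀ n, IdentDistrib (V₁ n) (V₁ 0) P P)
    (hV₂_ident : ∀ n, IdentDistrib (V₂ n) (V₂ 0) P P)
    (hVW₁ : ∀ n, V₁ n ⟂ᵢ[P] W₁ n) (hVW₂ : ∀ n, V₂ n ⟂ᵢ[P] W₂ n)
    (hb₁ : ∀ᵐ ω ∂P, ∃ M, ∀ n : ℕ, -(W₁ n ω + n * c) ≤ M)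
    (hb₂ : ∀ᵐ ω ∂P, ∃ M, ∀ n : ℕ, -(W₂ n ω + n * c₂) ≤ M)
    (hU₁ : ∀ x n, ∀ᵐ ω ∂P, x < W₁ n ω + V₁ n ω → ω ∈ U x)
    (hU₂ : ∀ x n, ∀ᵐ ω ∂P, x < W₂ n ω + V₂ n ω → ω ∈ U x)
    (hd₁ : 0 ≤ d₁) (hd₂ : 0 ≤ d₂) (ht₁ : HasTailSums P ν (V₁ 0) d₁)
    (ht₂ : HasTailSums P ν (V₂ 0) d₂) (hc : 0 < c) (hc₂ : 0 < c₂) {h : ℝ}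
    (hh : h < d₁ / c + d₂ / c₂) :
    ∀ᶠ x in atTop, h * ν.real (Ioi x) ≤ P.real (U x) := by
  have := hν.prob
  set m := d₁ / c + d₂ / c₂ with hm
  have hm0 : 0 ≤ m := by positivity
  obtain ⟨ε, hε, hεm⟩ : ∃ ε > 0, h < (1 - ε) * m := by
    refine ⟨(m - h) / (m + 1), div_pos (by linarith) (by linarith), ?_⟩
    have : (m - h) / (m + 1) * m < m - h := by
      rw [div_mul_eq_mul_div, div_lt_iff₀ (by linarith)]
      nlinarith
    linarith
  -- Since `W₁` stays above `-T₁ - n c` for all `n` with probability above `1 - ε`, a jump beyond `x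
  -- + T₁ + n c` lifts the path above `x`; `T₂` plays the same role for `W₂`.
  obtain ⟨T₁, -, hT₁⟩ := exists_measureReal_iUnion_lt (P := P)
    (f := fun n ω => -(W₁ n ω + n * c)) (fun n => ((hW₁ n).add_const _).neg) hb₁ hε
  obtain ⟨T₂, -, hT₂⟩ := exists_measureReal_iUnion_lt (P := P)
    (f := fun n ω => -(W₂ n ω + n * c₂)) (fun n => ((hW₂ n).add_const _).neg) hb₂ hε
  set s : ℝ → ℝ := fun x => ∑' k : ℕ, P.real {ω | x + T₁ + k * c < V₁ 0 ω} +
    ∑' k : ℕ, P.real {ω | x + T₂ + k * c₂ < V₂ 0 ω} with hs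
  have hslim : Tendsto (fun x => s x / ν.real (Ioi x)) atTop (𝓝 m) := by
    simpa only [hs, add_div] using (ht₁.tendsto c hc T₁).add (ht₂.tendsto c₂ hc₂ T₂)
  have hs0 : Tendsto s atTop (𝓝 0) := by
    have := hslim.mul (tendsto_real_Ioi_zero ν)
    rw [mul_zero] at this
    exact this.congr fun x => div_mul_cancel₀ _ (hν.real_pos x).ne'
  have hlim : Tendsto (fun x => (1 - ε - s x) * (s x / ν.real (Ioi x))) atTop
      (𝓝 ((1 - ε) * m)) := by
    simpa using (tendsto_const_nhds.sub hs0).mul hslim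
  filter_upwards [hlim.eventually (lt_mem_nhds hεm), eventually_ge_atTop (-T₁),
    eventually_ge_atTop (-T₂)] with x hx hx₁ hx₂
  set B : ℕ ⊕ ℕ → Set Ω := Sum.elim (fun n : ℕ => {ω | x + T₁ + n * c < V₁ n ω})
    (fun n : ℕ => {ω | x + T₂ + n * c₂ < V₂ n ω}) with hB
  set G : ℕ ⊕ ℕ → Set Ω := Sum.elim (fun n : ℕ => {ω | -(W₁ n ω + n * c) ≤ T₁})
    (fun n : ℕ => {ω | -(W₂ n ω + n * c₂) ≤ T₂}) with hG
  have hGm₁ : ∀ n : ℕ, MeasurableSet {v : ℝ | -(v + n * c) ≤ T₁} := fun n =>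
    measurableSet_le (by fun_prop) measurable_const
  have hGm₂ : ∀ n : ℕ, MeasurableSet {v : ℝ | -(v + n * c₂) ≤ T₂} := fun n =>
    measurableSet_le (by fun_prop) measurable_const
  have hpB₁ : ∀ n, P.real (B (Sum.inl n)) = P.real {ω | x + T₁ + n * c < V₁ 0 ω} := fun n =>
    congrArg ENNReal.toReal ((hV₁_ident n).measure_mem_eq (s := Ioi _) measurableSet_Ioi)
  have hpB₂ : ∀ n, P.real (B (Sum.inr n)) = P.real {ω | x + T₂ + n * c₂ < V₂ 0 ω} := fun n =>
    congrArg ENNReal.toReal ((hV₂_ident n).measure_mem_eq (s := Ioi _) measurableSet_Ioi)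
  have hsum₁ := ht₁.summable c hc (x + T₁) (by linarith)
  have hsum₂ := ht₂.summable c₂ hc₂ (x + T₂) (by linarith)
  have hHas : HasSum (fun i => P.real (B i)) (s x) := by
    refine HasSum.sum (f := fun i => P.real (B i)) ?_ ?_
    · simpa only [Function.comp_def, hpB₁] using hsum₁.hasSum
    · simpa only [Function.comp_def, hpB₂] using hsum₂.hasSum
  have hF : ∀ F : Finset (ℕ ⊕ ℕ), ∑ i ∈ F, P.real (B i) * (1 - ε - s x) ≤ P.real (U x) := by
    intro F
    refine sum_mul_le_measureReal_of_rare (B := B) (G := G) ?_ ?_ ?_ ?_ ?_ ?_ F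
      (sum_le_hasSum F (fun _ _ => measureReal_nonneg) hHas)
    · rintro (n | n)
      exacts [hV₁ n measurableSet_Ioi, hV₂ n measurableSet_Ioi]
    · rintro (n | n)
      exacts [hW₁ n (hGm₁ n), hW₂ n (hGm₂ n)]
    · have key : ∀ {f : ℕ → Ω → ℝ} {T : ℝ}, (∀ n, Measurable (f n)) →
          P.real (⋃ n, {ω | T < f n ω}) < ε → ∀ n, 1 - ε ≤ P.real {ω | f n ω ≤ T} := by
        intro f T hf hfT n
        have e : {ω | f n ω ≤ T} = {ω | T < f n ω}ᶜ := by ext ω; simp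
        rw [e, probReal_compl_eq_one_sub (measurableSet_lt measurable_const (hf n))]
        have := measureReal_mono (μ := P) (subset_iUnion (fun n => {ω | T < f n ω}) n)
        linarith
      rintro (n | n)
      · exact key (f := fun n ω => -(W₁ n ω + n * c)) (fun n => ((hW₁ n).add_const _).neg) hT₁ n
      · exact key (f := fun n ω => -(W₂ n ω + n * c₂)) (fun n => ((hW₂ n).add_const _).neg) hT₂ n
    · rintro (n | n)
      · have := (hVW₁ n).measure_inter_preimage_eq_mul (Ioi (x + T₁ + n * c)) _ measurableSet_Ioi
          (hGm₁ n)
        exact (congrArg ENNReal.toReal this).trans ENNReal.toReal_mul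
      · have := (hVW₂ n).measure_inter_preimage_eq_mul (Ioi (x + T₂ + n * c₂)) _ measurableSet_Ioi
          (hGm₂ n)
        exact (congrArg ENNReal.toReal this).trans ENNReal.toReal_mul
    · have hBp : ∀ i, ∃ t, B i = Sum.elim V₁ V₂ i ⁻¹' Ioi t := by
        rintro (n | n)
        exacts [⟨_, rfl⟩, ⟨_, rfl⟩]
      intro i j hij
      obtain ⟨t, ht⟩ := hBp i
      obtain ⟨t', ht'⟩ := hBp j
      rw [ht, ht']
      have := (hV.indepFun hij).measure_inter_preimage_eq_mul (Ioi t) (Ioi t') measurableSet_Ioi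
        measurableSet_Ioi
      exact (congrArg ENNReal.toReal this).trans ENNReal.toReal_mul
    · rintro (n | n)
      · filter_upwards [hU₁ x n] with ω h1 (h2 : x + T₁ + n * c < V₁ n ω)
          (h3 : -(W₁ n ω + n * c) ≤ T₁)
        exact h1 (by linarith)
      · filter_upwards [hU₂ x n] with ω h1 (h2 : x + T₂ + n * c₂ < V₂ n ω)
          (h3 : -(W₂ n ω + n * c₂) ≤ T₂)
        exact h1 (by linarith)
  -- The finite bounds pass to the full series. As `s x → 0`, the correction `1 - ε - s x` tends to
  -- `1 - ε`.
  have hle : s x * (1 - ε - s x) ≤ P.real (U x) :=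
    hasSum_le_of_sum_le (hHas.mul_right _) hF
  have hp := hν.real_pos x
  rw [← mul_div_assoc, lt_div_iff₀ hp] at hx
  linarith

end

theorem ProbabilityTheory.iIndepFun.indepFun_of_measurable_iSup {Ω ι : Type*} [MeasurableSpace Ω] {P : Measure Ω}
    {f : ι → Ω → ℝ}
    (hf : ∀ i, Measurable (f i)) (h : iIndepFun f P) {S T : Set ι} (hST : Disjoint S T)
    {u v : Ω → ℝ}
    (hu : Measurable[⨆ i ∈ S, MeasurableSpace.comap (f i) inferInstance] u)
    (hv : Measurable[⨆ i ∈ T, MeasurableSpace.comap (f i) inferInstance] v) : u ⟂ᵢ[P] v :=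
  (IndepFun_iff_Indep u v P).2 (indep_of_indep_of_le_left (indep_of_indep_of_le_right
    (indep_iSup_of_disjoint (fun i => (hf i).comap_le) h.iIndep hST) hv.comap_le) hu.comap_le)

theorem measurable_iSup_comap {Ω ι : Type*} (f : ι → Ω → ℝ) {S : Set ι} {i : ι} (hi : i ∈ S) :
    Measurable[⨆ i ∈ S, MeasurableSpace.comap (f i) inferInstance] (f i) :=
  (comap_measurable (f i)).mono (le_biSup (fun i => MeasurableSpace.comap (f i) _) hi) le_rfl

/-! ### Tails and integrability of service times -/

section Tails

variable {Ω : Type*} [MeasurableSpace Ω] {P : Measure Ω}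

theorem HasTailSums.congr {ν : Measure ℝ} {V V' : Ω → ℝ} {d : ℝ} (h : HasTailSums P ν V d)
    (hVV' : IdentDistrib V V' P P) : HasTailSums P ν V' d := by
  have e : ∀ x, P.real {ω | x < V ω} = P.real {ω | x < V' ω} := fun x =>
    congrArg ENNReal.toReal (hVV'.measure_mem_eq (s := Ioi x) measurableSet_Ioi)
  exact ⟨by simpa only [e] using h.summable, by simpa only [e] using h.tendsto⟩

theorem antitone_measureReal_lt [IsFiniteMeasure P] (V : Ω → ℝ) : Antitone fun x => P.real {ω | x < V ω} :=
  fun _ _ h => measureReal_mono fun _ hω => lt_of_le_of_lt h hω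

/-- The layer-cake formula; it supplies the finite means needed for the law of large numbers. -/
theorem integrable_of_integrableOn_tail [IsFiniteMeasure P] {V : Ω → ℝ} (hV : Measurable V) (hV0 : ∀ᵐ ω ∂P, 0 ≤ V ω)
    (h : IntegrableOn (fun x => P.real {ω | x < V ω}) (Ioi 0)) : Integrable V P := by
  refine ⟨hV.aestronglyMeasurable, ?_⟩
  rw [hasFiniteIntegral_iff_ofReal hV0, lintegral_eq_lintegral_meas_lt P hV0 hV.aemeasurable]
  have := h.2
  rw [hasFiniteIntegral_iff_ofReal (Eventually.of_forall fun _ => measureReal_nonneg)] at this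
  simpa only [ofReal_measureReal (measure_ne_top P _)] using this

end Tails

theorem setOf_lt_stationaryDelay {Ω : Type*} (T σ₁ σ₂ : ℤ → Ω → ℝ) (x : ℝ) :
    {ω | (x : EReal) < stationaryDelay (fun n => T n ω) (fun n => σ₁ n ω) (fun n => σ₂ n ω)} =
      ⋃ n, {ω | x < delayFrom (fun n => T n ω) (fun n => σ₁ n ω) (fun n => σ₂ n ω) n} := by
  ext ω
  simp [stationaryDelay, lt_iSup_iff]

/-! ### The two one-sided bounds for the stationary delay -/

section Delay

variable {Ω : Type*} [MeasurableSpace Ω] {P : Measure Ω} [IsProbabilityMeasure P]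

/-- Continuity from below along the nondecreasing `delayFrom`; this is why the upper bounds must be
uniform in `n`. -/
theorem measureReal_lt_stationaryDelay_le {T σ₁ σ₂ : ℤ → Ω → ℝ} {x C : ℝ}
    (h : ∀ n, P.real {ω | x < delayFrom (fun n => T n ω) (fun n => σ₁ n ω) (fun n => σ₂ n ω) n}
      ≤ C) :
    P.real {ω | (x : EReal) < stationaryDelay (fun n => T n ω) (fun n => σ₁ n ω)
      (fun n => σ₂ n ω)} ≤ C := by
  rw [setOf_lt_stationaryDelay, Measure.real, Monotone.measure_iUnion]
  · refine ENNReal.toReal_le_of_le_ofReal (measureReal_nonneg.trans (h 0)) (iSup_le fun n => ?_)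
    rw [← ofReal_measureReal]
    exact ENNReal.ofReal_le_ofReal (h n)
  · exact fun m n hmn ω (hω : x < _) => hω.trans_le (monotone_delayFrom _ _ _ hmn)

variable {T τ σ₁ σ₂ : ℤ → Ω → ℝ} (hτ : ∀ n ω, τ n ω = T (n + 1) ω - T n ω)
  (hτ_meas : ∀ n, Measurable (τ n)) (hσ₁_meas : ∀ n, Measurable (σ₁ n))
  (hσ₂_meas : ∀ n, Measurable (σ₂ n))
  (hτ_nonneg : ∀ n, ∀ᵐ ω ∂P, 0 ≤ τ n ω) (hσ₁_nonneg : ∀ n, ∀ᵐ ω ∂P, 0 ≤ σ₁ n ω)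
  (hσ₂_nonneg : ∀ n, ∀ᵐ ω ∂P, 0 ≤ σ₂ n ω)
  (h_indep : iIndepFun (Sum.elim τ (Sum.elim σ₁ σ₂)) P)
  (hτ_ident : ∀ n, IdentDistrib (τ n) (τ 0) P P)
  (hσ₁_ident : ∀ n, IdentDistrib (σ₁ n) (σ₁ 0) P P)
  (hσ₂_ident : ∀ n, IdentDistrib (σ₂ n) (σ₂ 0) P P)
  (hτ_int : Integrable (τ 0) P) (hσ₁_int : Integrable (σ₁ 0) P) (hσ₂_int : Integrable (σ₂ 0) P)
  {ν : Measure ℝ} (hν : IsSubexpLaw ν) {d₁ d₂ : ℝ} (hd₁ : 0 ≤ d₁) (hd₂ : 0 ≤ d₂)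
  (ht₁ : HasTailSums P ν (σ₁ 0) d₁) (ht₂ : HasTailSums P ν (σ₂ 0) d₂)
  {c c₂ h : ℝ} (hc : 0 < c) (hc₂ : 0 < c₂)

include hτ hτ_meas hσ₁_meas hσ₂_meas hσ₁_nonneg hσ₂_nonneg h_indep hτ_ident hσ₁_ident hσ₂_ident
  hτ_int hσ₁_int hσ₂_int hν hd₁ hd₂ ht₁ ht₂ hc hc₂

include hτ_nonneg in
theorem eventually_stationaryDelay_le
    (hn₁ : ∀ m > 0, ∀ᶠ x in atTop, P.real {ω | x < σ₁ 0 ω} ≤ m * ν.real (Ioi x))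
    (hn₂ : ∀ m > 0, ∀ᶠ x in atTop, P.real {ω | x < σ₂ 0 ω} ≤ m * ν.real (Ioi x))
    (hc₁' : c < (∫ ω, τ 0 ω ∂P) - ∫ ω, σ₁ 0 ω ∂P) (hc' : c < (∫ ω, τ 0 ω ∂P) - ∫ ω, σ₂ 0 ω ∂P)
    (hc₂' : c₂ < (∫ ω, τ 0 ω ∂P) - ∫ ω, σ₂ 0 ω ∂P) (hh : d₁ / c + d₂ / c₂ < h) :
    ∀ᶠ x : ℝ in atTop, P.real {ω | (x : EReal) < stationaryDelay (fun n => T n ω)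
      (fun n => σ₁ n ω) (fun n => σ₂ n ω)} ≤ h * ν.real (Ioi x) := by
  set f := Sum.elim τ (Sum.elim σ₁ σ₂) with hf
  have hfm : ∀ i, Measurable (f i) := by
    rintro (i | i | i)
    exacts [hτ_meas i, hσ₁_meas i, hσ₂_meas i]
  set A : ℕ → Ω → ℝ := fun k => τ (-1 - k) with hA
  set X : ℕ → Ω → ℝ := fun k => σ₁ (-1 - k) with hX
  set Y : ℕ → Ω → ℝ := fun k => σ₂ (-2 - k) with hY
  obtain ⟨h', hh', hh'h⟩ := exists_between hh
  have hAX : iIndepFun (Sum.elim A (Sum.elim X Y)) P := by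
    have h1 : Function.Injective fun k : ℕ => (-1 - k : ℤ) := fun i j hij => by
      simpa using hij
    have h2 : Function.Injective fun k : ℕ => (-2 - k : ℤ) := fun i j hij => by
      simpa using hij
    convert! h_indep.precomp (h1.sumMap (h1.sumMap h2)) using 2 with i
    rcases i with i | i | i <;> rfl
  have hmain := eventually_tandemMax_le hν (A := A) (X := X) (Y := Y) (fun k => hτ_meas _)
    (fun k => hσ₁_meas _) (fun k => hσ₂_meas _) (fun k => hτ_nonneg _) hAX
    (fun k => (hτ_ident _).trans (hτ_ident _).symm)
    (fun k => (hσ₁_ident _).trans (hσ₁_ident _).symm)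
    (fun k => (hσ₂_ident _).trans (hσ₂_ident _).symm)
    ((hτ_ident _).integrable_iff.2 hτ_int) ((hσ₁_ident _).integrable_iff.2 hσ₁_int)
    ((hσ₂_ident _).integrable_iff.2 hσ₂_int) hd₁ hd₂
    (ht₁.congr (hσ₁_ident _).symm) (ht₂.congr (hσ₂_ident _).symm) hc hc₂
    (by rw [(hτ_ident _).integral_eq, (hσ₁_ident _).integral_eq]; exact hc₁')
    (by rw [(hτ_ident _).integral_eq, (hσ₂_ident _).integral_eq]; exact hc')
    (by rw [(hτ_ident _).integral_eq, (hσ₂_ident _).integral_eq]; exact hc₂') hh'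
  set Q : ℕ → Ω → ℝ := fun n ω => tandemMax (fun k => A k ω) (fun k => X k ω) (fun k => Y k ω) n
    with hQ
  have hQm : ∀ n, Measurable (Q n) := fun n =>
    measurable_tandemMax (fun k _ => hτ_meas _) (fun k _ => hσ₁_meas _) (fun k _ => hσ₂_meas _)
  have hn₂' : ∀ m > 0, ∀ᶠ x in atTop, P.real {ω | x < σ₂ (-1) ω} ≤ m * ν.real (Ioi x) := by
    have e : ∀ x, P.real {ω | x < σ₂ (-1) ω} = P.real {ω | x < σ₂ 0 ω} := fun x =>
      congrArg ENNReal.toReal ((hσ₂_ident (-1)).measure_mem_eq (s := Ioi x) measurableSet_Ioi)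
    simpa only [e] using hn₂
  have hBm : Measurable fun ω => σ₂ 0 ω + (σ₂ (-1) ω + σ₁ 0 ω) :=
    (hσ₂_meas 0).add ((hσ₂_meas _).add (hσ₁_meas 0))
  have hBind : σ₂ 0 ⟂ᵢ[P] fun ω => σ₂ (-1) ω + σ₁ 0 ω := by
    have := h_indep.indepFun_prodMk hfm (Sum.inr (Sum.inr (-1))) (Sum.inr (Sum.inl 0))
      (Sum.inr (Sum.inr 0)) (by simp) (by simp)
    exact (this.comp (φ := fun p : ℝ × ℝ => p.1 + p.2) (ψ := id) (by fun_prop) measurable_id).symm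
  have hBtail := hν.negligible_add hBind (hσ₂_meas 0) ((hσ₂_meas _).add (hσ₁_meas 0)) hn₂
    (hν.negligible_add (h_indep.indepFun (i := Sum.inr (Sum.inr (-1))) (j := Sum.inr (Sum.inl 0))
      (by simp)) (hσ₂_meas _) (hσ₁_meas 0) hn₂' hn₁)
  simp_rw [← map_real_Ioi hBm] at hBtail
  have hBQ : ∀ n, (fun ω => σ₂ 0 ω + (σ₂ (-1) ω + σ₁ 0 ω)) ⟂ᵢ[P] Q n := by
    intro n
    -- The three services set apart in `delayFrom_le`; the shifted sequences `A`, `X`, `Y` avoid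
    -- them.
    set I : Set (ℤ ⊕ ℤ ⊕ ℤ) := {Sum.inr (Sum.inr 0), Sum.inr (Sum.inr (-1)), Sum.inr (Sum.inl 0)}
      with hI
    refine h_indep.indepFun_of_measurable_iSup hfm (disjoint_compl_right (a := I)) ?_ ?_
    · exact (measurable_iSup_comap f (S := I) (i := Sum.inr (Sum.inr 0)) (by simp [hI])).add
        ((measurable_iSup_comap f (S := I) (i := Sum.inr (Sum.inr (-1))) (by simp [hI])).add
          (measurable_iSup_comap f (S := I) (i := Sum.inr (Sum.inl 0)) (by simp [hI])))
    · exact measurable_tandemMax (A := A) (X := X) (Y := Y)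
        (fun k _ => measurable_iSup_comap f (S := Iᶜ) (i := Sum.inl (-1 - k)) (by simp [hI]))
        (fun k _ => measurable_iSup_comap f (S := Iᶜ) (i := Sum.inr (Sum.inl (-1 - k)))
          (by simp [hI]; omega))
        (fun k _ => measurable_iSup_comap f (S := Iᶜ) (i := Sum.inr (Sum.inr (-2 - k)))
          (by simp [hI]; omega))
  have := Measure.isProbabilityMeasure_map (μ := P) hBm.aemeasurable
  have hprob : ∀ n, IsProbabilityMeasure (P.map (Q n)) := fun n =>
    Measure.isProbabilityMeasure_map (hQm n).aemeasurable
  have hfin := hν.eventually_prod_le_of_negligible (ρ := fun n => P.map (Q n)) (K := h')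
    (le_trans (by positivity) hh'.le) hBtail
    (by simpa only [map_real_Ioi (hQm _)] using hmain) hh'h
  filter_upwards [hfin] with x hx
  refine measureReal_lt_stationaryDelay_le fun n => ?_
  refine le_trans ?_ (hx n)
  rw [← (hBQ n).measureReal_add_gt hBm (hQm n)]
  refine ENNReal.toReal_mono (measure_ne_top _ _) (measure_mono_ae ?_)
  filter_upwards [hσ₁_nonneg 0, hσ₂_nonneg (-1)] with ω h1 h2 h3
  exact lt_of_lt_of_le h3 (delayFrom_le (T := fun n => T n ω) (τ := fun n => τ n ω) (fun n => hτ n ω) (s₁ := fun n => σ₁ n ω)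
    (s₂ := fun n => σ₂ n ω) h1 h2 n)

theorem eventually_le_stationaryDelay
    (hc' : (∫ ω, τ 0 ω ∂P) - max (∫ ω, σ₁ 0 ω ∂P) (∫ ω, σ₂ 0 ω ∂P) < c)
    (hc₂' : (∫ ω, τ 0 ω ∂P) - ∫ ω, σ₂ 0 ω ∂P < c₂) (hh : h < d₁ / c + d₂ / c₂) :
    ∀ᶠ x : ℝ in atTop, h * ν.real (Ioi x) ≤ P.real {ω | (x : EReal) <
      stationaryDelay (fun n => T n ω) (fun n => σ₁ n ω) (fun n => σ₂ n ω)} := by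
  set f := Sum.elim τ (Sum.elim σ₁ σ₂) with hf
  have hfm : ∀ i, Measurable (f i) := by
    rintro (i | i | i)
    exacts [hτ_meas i, hσ₁_meas i, hσ₂_meas i]
  set U : ℝ → Set Ω := fun x => {ω | (x : EReal) < stationaryDelay (fun n => T n ω)
    (fun n => σ₁ n ω) (fun n => σ₂ n ω)} with hU
  have hUmem : ∀ {x : ℝ} {ω} (n : ℕ), x < delayFrom (fun n => T n ω) (fun n => σ₁ n ω)
      (fun n => σ₂ n ω) n → ω ∈ U x := by
    intro x ω n hx
    simp only [hU, setOf_lt_stationaryDelay]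
    exact mem_iUnion.2 ⟨n, hx⟩
  have hneg : Function.Injective fun k : ℕ => (-k : ℤ) := fun i j hij => by simpa using hij
  have hneg1 : Function.Injective fun k : ℕ => (-1 - k : ℤ) := fun i j hij => by simpa using hij
  set A : ℕ → Ω → ℝ := fun k => τ (-1 - k) with hA
  set V₁ : ℕ → Ω → ℝ := fun k => σ₁ (-k) with hV₁
  set V₂ : ℕ → Ω → ℝ := fun k => σ₂ (-k) with hV₂
  set W₁ : ℕ → Ω → ℝ := fun n ω => walk (fun k => A k ω) (fun k => V₁ k ω) n with hW₁
  set W₂ : ℕ → Ω → ℝ := fun n ω => walk (fun k => A k ω) (fun k => V₂ k ω) n with hW₂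
  have hW₁m : ∀ n, Measurable (W₁ n) := fun n =>
    measurable_walk (fun k _ => hτ_meas _) (fun k _ => hσ₁_meas _)
  have hW₂m : ∀ n, Measurable (W₂ n) := fun n =>
    measurable_walk (fun k _ => hτ_meas _) (fun k _ => hσ₂_meas _)
  have hV : iIndepFun (Sum.elim V₁ V₂) P := by
    convert! h_indep.precomp (Sum.inr_injective.comp (hneg.sumMap hneg)) using 2 with i
    rcases i with i | i <;> rfl
  have lower : ∀ {u : ℕ → ℝ} {l c : ℝ}, Tendsto (fun n : ℕ => u n / n) atTop (𝓝 l) → -l < c →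
      ∃ M, ∀ n : ℕ, -(u n + n * c) ≤ M := by
    intro u l c hu hl
    obtain ⟨C, hC⟩ := exists_abs_sub_le_of_tendsto_div hu (show 0 < c + l by linarith)
    exact ⟨C, fun n => by linarith [(abs_le.1 (hC n)).1]⟩
  have hS₁ : ∀ᵐ ω ∂P, Tendsto (fun n : ℕ => W₁ n ω / n) atTop
      (𝓝 ((∫ ω, σ₁ 0 ω ∂P) - ∫ ω, τ 0 ω ∂P)) := by
    have := ae_tendsto_walk_div (A := A) (Y := V₁) (P := P) (fun k => hτ_meas _)
      (fun k => hσ₁_meas _) (by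
        convert! h_indep.precomp (hneg1.sumMap (Sum.inl_injective.comp hneg)) using 2 with i
        rcases i with i | i <;> rfl)
      (fun k => (hτ_ident _).trans (hτ_ident _).symm)
      (fun k => (hσ₁_ident _).trans (hσ₁_ident _).symm)
      ((hτ_ident _).integrable_iff.2 hτ_int) ((hσ₁_ident _).integrable_iff.2 hσ₁_int)
    rwa [(hτ_ident _).integral_eq, (hσ₁_ident _).integral_eq] at this
  have hS₂ : ∀ᵐ ω ∂P, Tendsto (fun n : ℕ => W₂ n ω / n) atTop
      (𝓝 ((∫ ω, σ₂ 0 ω ∂P) - ∫ ω, τ 0 ω ∂P)) := by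
    have := ae_tendsto_walk_div (A := A) (Y := V₂) (P := P) (fun k => hτ_meas _)
      (fun k => hσ₂_meas _) (by
        convert! h_indep.precomp (hneg1.sumMap (Sum.inr_injective.comp hneg)) using 2 with i
        rcases i with i | i <;> rfl)
      (fun k => (hτ_ident _).trans (hτ_ident _).symm)
      (fun k => (hσ₂_ident _).trans (hσ₂_ident _).symm)
      ((hτ_ident _).integrable_iff.2 hτ_int) ((hσ₂_ident _).integrable_iff.2 hσ₂_int)
    rwa [(hτ_ident _).integral_eq, (hσ₂_ident _).integral_eq] at this
  have ind₁ : ∀ n, V₁ n ⟂ᵢ[P] W₁ n := fun n =>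
    h_indep.indepFun_of_measurable_iSup hfm
      (disjoint_compl_right (a := {Sum.inr (Sum.inl (-(n : ℤ)))}))
      (measurable_iSup_comap f (i := Sum.inr (Sum.inl (-(n : ℤ)))) rfl)
      (measurable_walk (A := A) (Y := V₁)
        (fun k _ => measurable_iSup_comap f (i := Sum.inl (-1 - k)) (by simp))
        (fun k hk => measurable_iSup_comap f (i := Sum.inr (Sum.inl (-k))) (by simp; omega)))
  have ind₁₂ : ∀ n, V₁ n ⟂ᵢ[P] W₂ n := fun n =>
    h_indep.indepFun_of_measurable_iSup hfm
      (disjoint_compl_right (a := {Sum.inr (Sum.inl (-(n : ℤ)))}))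
      (measurable_iSup_comap f (i := Sum.inr (Sum.inl (-(n : ℤ)))) rfl)
      (measurable_walk (A := A) (Y := V₂)
        (fun k _ => measurable_iSup_comap f (i := Sum.inl (-1 - k)) (by simp))
        (fun k hk => measurable_iSup_comap f (i := Sum.inr (Sum.inr (-k))) (by simp)))
  have ind₂ : ∀ n, V₂ n ⟂ᵢ[P] W₂ n := fun n =>
    h_indep.indepFun_of_measurable_iSup hfm
      (disjoint_compl_right (a := {Sum.inr (Sum.inr (-(n : ℤ)))}))
      (measurable_iSup_comap f (i := Sum.inr (Sum.inr (-(n : ℤ)))) rfl)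
      (measurable_walk (A := A) (Y := V₂)
        (fun k _ => measurable_iSup_comap f (i := Sum.inl (-1 - k)) (by simp))
        (fun k hk => measurable_iSup_comap f (i := Sum.inr (Sum.inr (-k))) (by simp; omega)))
  have hU₂ : ∀ x n, ∀ᵐ ω ∂P, x < W₂ n ω + V₂ n ω → ω ∈ U x := by
    intro x n
    filter_upwards [hσ₁_nonneg (-n)] with ω h1 h2
    have := walk_add_service₂_le_delayFrom (T := fun n => T n ω) (τ := fun n => τ n ω)
      (fun n => hτ n ω) (fun n => σ₁ n ω)
      (fun n => σ₂ n ω) n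
    exact hUmem n (lt_of_lt_of_le (lt_of_lt_of_le h2 (le_add_of_nonneg_right h1)) this)
  -- Only the path carrying a jump at station 1 depends on the bottleneck, so `W` is left open: `W₂`
  -- if `b₁ ≤ b₂`, and `W₁` if `b₂ ≤ b₁`. Either way its drift is `-(a - b)`.
  have final : ∀ W : ℕ → Ω → ℝ, (∀ n, Measurable (W n)) → (∀ n, V₁ n ⟂ᵢ[P] W n) →
      (∀ᵐ ω ∂P, ∃ M, ∀ n : ℕ, -(W n ω + n * c) ≤ M) →
      (∀ x n, ∀ᵐ ω ∂P, x < W n ω + V₁ n ω → ω ∈ U x) →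
      ∀ᶠ x in atTop, h * ν.real (Ioi x) ≤ P.real (U x) := fun W hWm hind hb hUW =>
    eventually_le_of_single_big_jump hν (V₁ := V₁) (V₂ := V₂) (W₁ := W) (W₂ := W₂)
      (fun _ => hσ₁_meas _) (fun _ => hσ₂_meas _) hWm hW₂m hV
      (fun k => (hσ₁_ident _).trans (hσ₁_ident _).symm)
      (fun k => (hσ₂_ident _).trans (hσ₂_ident _).symm) hind ind₂ hb
      (hS₂.mono fun ω hω => lower hω (by linarith)) hUW hU₂ hd₁ hd₂
      (ht₁.congr (hσ₁_ident _).symm) (ht₂.congr (hσ₂_ident _).symm) hc hc₂ hh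
  rcases le_total (∫ ω, σ₁ 0 ω ∂P) (∫ ω, σ₂ 0 ω ∂P) with hle | hle
  · rw [max_eq_right hle] at hc'
    refine final W₂ hW₂m ind₁₂ (hS₂.mono fun ω hω => lower hω (by linarith)) fun x n => ?_
    filter_upwards [hσ₂_nonneg (-n)] with ω (h1 : 0 ≤ V₂ n ω) h2
    have h3 : W₂ n ω + V₂ n ω + V₁ n ω ≤ _ := walk_add_service₂_le_delayFrom
      (T := fun n => T n ω) (τ := fun n => τ n ω) (fun n => hτ n ω) (fun n => σ₁ n ω) (fun n => σ₂ n ω) n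
    exact hUmem n (lt_of_lt_of_le (by linarith) h3)
  · rw [max_eq_left hle] at hc'
    refine final W₁ hW₁m ind₁ (hS₁.mono fun ω hω => lower hω (by linarith)) fun x n => ?_
    filter_upwards [hσ₂_nonneg 0] with ω h1 h2
    exact hUmem n (lt_of_lt_of_le h2 (walk_add_service₁_le_delayFrom (T := fun n => T n ω) (τ := fun n => τ n ω)
      (fun n => hτ n ω)
      (fun n => σ₁ n ω) (fun n => σ₂ n ω) n h1))

end Delay

/-! ### Conclusion -/

theorem tendsto_div_of_eventually_bounds {f g : ℝ → ℝ} {l : ℝ} (hg : ∀ x, 0 < g x)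
    (hup : ∀ h > l, ∀ᶠ x in atTop, f x ≤ h * g x) (hlow : ∀ h < l, ∀ᶠ x in atTop, h * g x ≤ f x) :
    Tendsto (fun x => f x / g x) atTop (𝓝 l) := by
  refine tendsto_order.2 ⟨fun h hh => ?_, fun h hh => ?_⟩
  · obtain ⟨h', h1, h2⟩ := exists_between hh
    filter_upwards [hlow h' h2] with x hx
    exact h1.trans_le ((le_div_iff₀ (hg x)).2 hx)
  · obtain ⟨h', h1, h2⟩ := exists_between hh
    filter_upwards [hup h' h1] with x hx
    exact ((div_le_iff₀ (hg x)).2 hx).trans_lt h2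

theorem theorem9 {Ω : Type*} [MeasurableSpace Ω] (P : Measure Ω) [IsProbabilityMeasure P]
    -- arrival epochs, interarrival times, and service times at the two stations
    (T τ σ₁ σ₂ : ℤ → Ω → ℝ)
    (hτ : ∀ n ω, τ n ω = T (n + 1) ω - T n ω)
    (hτ_meas : ∀ n, Measurable (τ n)) (hσ₁_meas : ∀ n, Measurable (σ₁ n))
    (hσ₂_meas : ∀ n, Measurable (σ₂ n))
    (hτ_nonneg : ∀ n, ∀ᵐ ω ∂P, 0 ≤ τ n ω) (hσ₁_nonneg : ∀ n, ∀ᵐ ω ∂P, 0 ≤ σ₁ n ω)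
    (hσ₂_nonneg : ∀ n, ∀ᵐ ω ∂P, 0 ≤ σ₂ n ω)
    -- three i.i.d. sequences, independent of one another
    (h_indep : iIndepFun (Sum.elim τ (Sum.elim σ₁ σ₂)) P)
    (hτ_ident : ∀ n, IdentDistrib (τ n) (τ 0) P P)
    (hσ₁_ident : ∀ n, IdentDistrib (σ₁ n) (σ₁ 0) P P)
    (hσ₂_ident : ∀ n, IdentDistrib (σ₂ n) (σ₂ 0) P P)
    -- means and stability
    (a b₁ b₂ b : ℝ) (hτ_int : Integrable (τ 0) P)
    (ha : a = ∫ ω, τ 0 ω ∂P) (hb₁ : b₁ = ∫ ω, σ₁ 0 ω ∂P) (hb₂ : b₂ = ∫ ω, σ₂ 0 ω ∂P)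
    (hb : b = max b₁ b₂) (h_stable₁ : b₁ < a) (h_stable₂ : b₂ < a)
    -- the reference distribution function
    (F : ℝ → ℝ) (hF : IsSubexponential F) (hF_int : IntegrableOn (fun u => 1 - F u) (Ioi 0))
    (hFs : IsSubexponential (integratedTail F))
    -- tails of the service times
    (d₁ d₂ : ℝ) (hd₁ : 0 ≤ d₁) (hd₂ : 0 ≤ d₂) (hd : 0 < d₁ + d₂)
    (h_tail₁ : Tendsto (fun x : ℝ => P.real {ω | x < σ₁ 0 ω} / (1 - F x)) atTop (𝓝 d₁))
    (h_tail₂ : Tendsto (fun x : ℝ => P.real {ω | x < σ₂ 0 ω} / (1 - F x)) atTop (𝓝 d₂)) :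
    Tendsto
      (fun x : ℝ =>
        P.real {ω | (x : EReal) <
            stationaryDelay (fun n => T n ω) (fun n => σ₁ n ω) (fun n => σ₂ n ω)} /
          (1 - integratedTail F x))
      atTop (𝓝 (d₁ / (a - b) + d₂ / (a - b₂))) := by
  obtain ⟨ν, hν, hνF⟩ := hFs.exists_law
  obtain ⟨φ, hφ, hφF⟩ := hF.exists_law
  have := hν.prob
  have := hφ.prob
  have hint : IntegrableOn (fun u => φ.real (Ioi u)) (Ioi 0) :=
    hF_int.congr_fun (fun u hu => hφF u (le_of_lt hu)) measurableSet_Ioi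
  have hνφ : ∀ x, 0 ≤ x → ν.real (Ioi x) = min 1 (∫ u in Ioi x, φ.real (Ioi u)) := by
    intro x hx
    rw [← hνF x hx, integratedTail, sub_sub_cancel]
    congr 1
    exact setIntegral_congr_fun measurableSet_Ioi fun u hu => hφF u (hx.trans (le_of_lt hu))
  -- Tail equivalence with `F` is converted, for each station, into the three inputs of the bounds:
  -- a finite mean, the asymptotics of the tail sums, and negligibility of a single service time.
  have key : ∀ (V : Ω → ℝ) (d : ℝ), Measurable V → (∀ᵐ ω ∂P, 0 ≤ V ω) →
      Tendsto (fun x : ℝ => P.real {ω | x < V ω} / (1 - F x)) atTop (𝓝 d) →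
      Integrable V P ∧ HasTailSums P ν V d ∧
        ∀ m > 0, ∀ᶠ x in atTop, P.real {ω | x < V ω} ≤ m * ν.real (Ioi x) := by
    intro V d hV hV0 ht
    have hg := antitone_measureReal_lt (P := P) V
    have hg0 : ∀ x, 0 ≤ P.real {ω | x < V ω} := fun x => measureReal_nonneg
    have hgd : Tendsto (fun x => P.real {ω | x < V ω} / φ.real (Ioi x)) atTop (𝓝 d) := by
      refine ht.congr' ?_
      filter_upwards [eventually_ge_atTop 0] with x hx
      rw [hφF x hx]
    have hi := integrableOn_of_tail_equiv hint hg hg0 hgd hφ.real_pos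
    have h0 := tendsto_div_integratedTail hν hint hνφ hgd hφ.real_pos
    have hd := tendsto_integral_div_integratedTail hν hint hνφ hg hg0 hgd hφ.real_pos
    refine ⟨integrable_of_integrableOn_tail hV hV0 hi, ⟨fun c hc y hy => ?_, fun c hc s => ?_⟩,
      fun m hm => ?_⟩
    · exact (integral_div_le_tsum hg hg0 hc (hi.mono_set (Ioi_subset_Ioi hy))).1
    · exact hν.tendsto_tsum_div hg hg0 hi h0 hd hc s
    · filter_upwards [h0.eventually (gt_mem_nhds hm)] with x hx
      exact ((div_lt_iff₀ (hν.real_pos x)).1 hx).le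
  obtain ⟨hσ₁_int, ht₁, hn₁⟩ := key _ _ (hσ₁_meas 0) (hσ₁_nonneg 0) h_tail₁
  obtain ⟨hσ₂_int, ht₂, hn₂⟩ := key _ _ (hσ₂_meas 0) (hσ₂_nonneg 0) h_tail₂
  have hab : 0 < a - b := by rw [hb, sub_pos]; exact max_lt h_stable₁ h_stable₂
  have hab₂ : 0 < a - b₂ := by linarith
  have hcont : Tendsto (fun δ : ℝ => d₁ / (a - b + δ) + d₂ / (a - b₂ + δ)) (𝓝 0)
      (𝓝 (d₁ / (a - b) + d₂ / (a - b₂))) := by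
    have h : ContinuousAt (fun δ : ℝ => d₁ / (a - b + δ) + d₂ / (a - b₂ + δ)) 0 := by
      refine ContinuousAt.add (ContinuousAt.div (by fun_prop) (by fun_prop) ?_)
        (ContinuousAt.div (by fun_prop) (by fun_prop) ?_)
      · simpa using hab.ne'
      · simpa using hab₂.ne'
    simpa [ContinuousAt] using h
  have hb₁le : b₁ ≤ b := hb ▸ le_max_left _ _
  have hb₂le : b₂ ≤ b := hb ▸ le_max_right _ _
  have hlim : Tendsto (fun x : ℝ => P.real {ω | (x : EReal) <
      stationaryDelay (fun n => T n ω) (fun n => σ₁ n ω) (fun n => σ₂ n ω)} / ν.real (Ioi x)) atTop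
      (𝓝 (d₁ / (a - b) + d₂ / (a - b₂))) := by
    refine tendsto_div_of_eventually_bounds hν.real_pos (fun h hh => ?_) fun h hh => ?_
    -- For the upper bound the slopes lie below the drifts (`δ < 0`) but stay positive; for the
    -- lower bound they lie above (`δ > 0`). Continuity at `δ = 0` closes the gap.
    · obtain ⟨δ, ⟨hδ, hδab⟩, hδ0⟩ := (((hcont.mono_left nhdsWithin_le_nhds).eventually
        (gt_mem_nhds hh)).and ((tendsto_id.mono_left nhdsWithin_le_nhds).eventually
          (lt_mem_nhds (show -(a - b) < 0 by linarith)))).and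
        (self_mem_nhdsWithin : Iio (0 : ℝ) ∈ 𝓝[<] 0) |>.exists
      simp only [id] at hδab hδ0
      refine eventually_stationaryDelay_le hτ hτ_meas hσ₁_meas hσ₂_meas hτ_nonneg hσ₁_nonneg
        hσ₂_nonneg h_indep hτ_ident hσ₁_ident hσ₂_ident hτ_int hσ₁_int hσ₂_int hν hd₁ hd₂ ht₁ ht₂
        (c := a - b + δ) (c₂ := a - b₂ + δ) ?_ ?_ hn₁ hn₂ ?_ ?_ ?_ hδ
      all_goals linarith
    · obtain ⟨δ, hδ, hδ0⟩ := (((hcont.mono_left nhdsWithin_le_nhds).eventually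
        (lt_mem_nhds hh)).and (self_mem_nhdsWithin : Ioi (0 : ℝ) ∈ 𝓝[>] 0)).exists
      refine eventually_le_stationaryDelay hτ hτ_meas hσ₁_meas hσ₂_meas hσ₁_nonneg
        hσ₂_nonneg h_indep hτ_ident hσ₁_ident hσ₂_ident hτ_int hσ₁_int hσ₂_int hν hd₁ hd₂ ht₁ ht₂
        (c := a - b + δ) (c₂ := a - b₂ + δ) ?_ ?_ ?_ ?_ hδ
      · linarith
      · linarith
      · rw [← ha, ← hb₁, ← hb₂, ← hb]; linarith
      · linarith
  refine hlim.congr' ?_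
  filter_upwards [eventually_ge_atTop 0] with x hx
  rw [hνF x hx]
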